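/- Let $\mathcal N$ be a smooth manifold of dimension $\mathfrak n\ge 1$ with a symmetric $2$-covariant tensor field $\gamma$, a covector field $\boldsymbol\ell$, a function $\ell^{(2)}$ and a symmetric $2$-covariant tensor field $\mathbf Y$, all smooth, such that at each $p\in\mathcal N$ the symmetric form $\boldsymbol{\mathcal A}|_p((W,a),(Z,b))=\gamma(W,Z)+a\,\boldsymbol\ell(Z)+b\,\boldsymbol\ell(W)+ab\,\ell^{(2)}$ on $T_p\mathcal N\times\mathbb R$ is non-degenerate (hypersurface data). Let the vector field $n$ and the function $n^{(2)}$ be determined by $\boldsymbol{\mathcal A}((n,n^{(2)}),(Z,b))=b$ for all $(Z,b)$, and assume that the data is null, i.e. $n^{(2)}=0$ everywhere. Put $$\mathbf F=\tfrac12 d\boldsymbol\ell,\quad \boldsymbol s=\mathbf F(n,\cdot),\quad \boldsymbol r=\mathbf Y(n,\cdot),\quad \mathbf U=\tfrac12\pounds_n\gamma+\boldsymbol\ell\otimes_s dn^{(2)},$$ where $\alpha\otimes_s\beta=\frac12(\alpha\otimes\beta+\beta\otimes\alpha)$ (the last term of $\mathbf U$ vanishes for null data). For a nowhere zero smooth function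 $z$ and a smooth vector field $V$ on $\mathcal N$, the gauge transformation $\mathcal G_{(z,V)}$ replaces the data by $$\gamma'=\gamma,\quad \boldsymbol\ell'=z(\boldsymbol\ell+\gamma(V,\cdot)),\quad \ell^{(2)\prime}=z^2(\ell^{(2)}+2\boldsymbol\ell(V)+\gamma(V,V)),\quad \mathbf Y'=z\mathbf Y+\boldsymbol\ell\otimes_s dz+\tfrac12\pounds_{zV}\gamma ,$$ and for an object $Q$ constructed from the data, $\mathcal G_{(z,V)}(Q)$ denotes the same object constructed from the transformed data. Let $S$ be a smooth $(\mathfrak n-1)$-dimensional manifold and $\psi:S\hookrightarrow\mathcal N$ a smooth embedding such that $n$ is everywhere transverse to $\psi(S)$. Set $h=\psi^\star\gamma$ (a non-degenerate metric on $S$, with inverse $h^\sharp$), $\boldsymbol\ell_\parallel=\psi^\star\boldsymbol\ell$, $\ell_\parallel^\sharp=h^\sharp(\boldsymbol\ell_\parallel,\cdot)$, $\ell^{(2)}_\parallel=h^\sharp(\boldsymbol\ell_\parallel,\boldsymbol\ell_\parallel)$, $\mathbf U_\parallel=\psi^\star\mathbf U$, and define on $S$ the covector $\boldsymbol\omega_\parallel$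 and the $2$-covariant tensor $\boldsymbol{\mathfrak P}_\parallel$ by $$\boldsymbol\omega_\parallel=\psi^\star(\boldsymbol s-\boldsymbol r)-\mathbf U_\parallel(\ell_\parallel^\sharp,\cdot),\qquad \boldsymbol{\mathfrak P}_\parallel=\psi^\star\mathbf Y+\tfrac12\big(\ell^{(2)}_\parallel-\ell^{(2)}|_S\big)\mathbf U_\parallel-\tfrac12\pounds_{\ell_\parallel^\sharp}h .$$ Then $\boldsymbol{\mathfrak P}_\parallel$ is symmetric and, for all gauge parameters $\{z,V\}$, with $\hat z=\psi^\star z$, $$\mathcal G_{(z,V)}(\boldsymbol\omega_\parallel)=\boldsymbol\omega_\parallel-\frac1{\hat z}\,d\hat z,\qquad \mathcal G_{(z,V)}(\boldsymbol{\mathfrak P}_\parallel)=\hat z\,\boldsymbol{\mathfrak P}_\parallel .$$ -/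

import Mathlib

open scoped Manifold ContDiff

noncomputable section

namespace HypersurfaceData

/-! ### Covariant tensors on topological vector spaces -/

section Algebra

set_option linter.unusedSectionVars false

variable {V W : Type*}
  [AddCommGroup V] [Module ℝ V] [TopologicalSpace V]
  [IsTopologicalAddGroup V] [ContinuousSMul ℝ V]
  [AddCommGroup W] [Module ℝ W] [TopologicalSpace W]
  [IsTopologicalAddGroup W] [ContinuousSMul ℝ W]

/-- The bilinear form `(v, w) ↦ B (L v) (M w)`. -/
def bilinComp (B : W →L[ℝ] W →L[ℝ] ℝ) (L M : V →L[ℝ] W) : V →L[ℝ] V →L[ℝ] ℝ :=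
  (ContinuousLinearMap.precomp ℝ M) ∘L B ∘L L

@[simp] theorem bilinComp_apply (B : W →L[ℝ] W →L[ℝ] ℝ) (L M : V →L[ℝ] W) (v w : V) :
    bilinComp B L M v w = B (L v) (M w) := rfl

/-- The symmetrized tensor product `α ⊗ₛ β = ½ (α ⊗ β + β ⊗ α)` of two covectors. -/
def symProd (α β : V →L[ℝ] ℝ) : V →L[ℝ] V →L[ℝ] ℝ :=
  (1 / 2 : ℝ) • (α.smulRight β + β.smulRight α)

@[simp] theorem symProd_apply (α β : V →L[ℝ] ℝ) (v w : V) :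
    symProd α β v w = 1 / 2 * (α v * β w + β v * α w) := by
  simp [symProd]; ring

/-- A form on a finite-dimensional space without radical is invertible as a map to the dual
space, so that contracting with its inverse is meaningful. -/
theorem apply_inverse_of_nondegenerate [FiniteDimensional ℝ V] [T2Space V]
    (B : V →L[ℝ] V →L[ℝ] ℝ) (hB : ∀ x, (∀ y, B x y = 0) → x = 0) (α : V →L[ℝ] ℝ) :
    B (B.inverse α) = α := by
  have hinj : Function.Injective (B : V →ₗ[ℝ] (V →L[ℝ] ℝ)) := by
    rw [← LinearMap.ker_eq_bot, LinearMap.ker_eq_bot']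
    intro x hx
    exact hB x fun y ↦ by
      have : B x = 0 := hx
      simp [this]
  have hdim : Module.finrank ℝ V = Module.finrank ℝ (V →L[ℝ] ℝ) := by
    rw [← (LinearMap.toContinuousLinearMap (𝕜 := ℝ) (E := V) (F' := ℝ)).finrank_eq]
    exact Subspace.dual_finrank_eq.symm
  have : FiniteDimensional ℝ (V →L[ℝ] ℝ) :=
    (LinearMap.toContinuousLinearMap (𝕜 := ℝ) (E := V) (F' := ℝ)).finiteDimensional
  let e := (LinearEquiv.ofInjectiveOfFinrankEq (B : V →ₗ[ℝ] (V →L[ℝ] ℝ)) hinj hdim)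
  have he : (e.toContinuousLinearEquiv : V →L[ℝ] (V →L[ℝ] ℝ)) = B := by
    ext x y; rfl
  conv_lhs => rw [← he]
  simp

end Algebra

/-! ### Tensor fields on a manifold -/

section Fields

variable {E : Type*} [NormedAddCommGroup E] [NormedSpace ℝ E]
variable {M : Type*} [TopologicalSpace M] [ChartedSpace E M]
variable {F : Type*} [NormedAddCommGroup F] [NormedSpace ℝ F]
variable {S : Type*} [TopologicalSpace S] [ChartedSpace F S]

variable (E M) in
/-- (Rough) vector fields on `M`. -/
abbrev VecField : Type _ := ∀ p : M, TangentSpace 𝓘(ℝ, E) p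

variable (E M) in
/-- (Rough) covector fields on `M`. -/
abbrev CovecField : Type _ := ∀ p : M, TangentSpace 𝓘(ℝ, E) p →L[ℝ] ℝ

variable (E M) in
/-- (Rough) 2-covariant tensor fields on `M`. -/
abbrev FormField : Type _ :=
  ∀ p : M, TangentSpace 𝓘(ℝ, E) p →L[ℝ] TangentSpace 𝓘(ℝ, E) p →L[ℝ] ℝ

/-- `X` is a smooth section of the tangent bundle. -/
def VecField.Smooth [IsManifold 𝓘(ℝ, E) ∞ M] (X : VecField E M) : Prop :=
  ContMDiff 𝓘(ℝ, E) (𝓘(ℝ, E).prod 𝓘(ℝ, E)) ∞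
    (fun p : M ↦ Bundle.TotalSpace.mk' E p (X p))

/-- `α` is a smooth section of the cotangent bundle. -/
def CovecField.Smooth [IsManifold 𝓘(ℝ, E) ∞ M] (α : CovecField E M) : Prop :=
  ContMDiff 𝓘(ℝ, E) (𝓘(ℝ, E).prod 𝓘(ℝ, E →L[ℝ] ℝ)) ∞
    (fun p : M ↦ Bundle.TotalSpace.mk' (E →L[ℝ] ℝ) p (α p))

/-- `T` is a smooth section of the bundle of 2-covariant tensors. -/
def FormField.Smooth [IsManifold 𝓘(ℝ, E) ∞ M] (T : FormField E M) : Prop :=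
  ContMDiff 𝓘(ℝ, E) (𝓘(ℝ, E).prod 𝓘(ℝ, E →L[ℝ] E →L[ℝ] ℝ)) ∞
    (fun p : M ↦ Bundle.TotalSpace.mk' (E →L[ℝ] E →L[ℝ] ℝ) p (T p))

/-- `T` is a symmetric 2-covariant tensor field. -/
def FormField.Symmetric (T : FormField E M) : Prop :=
  ∀ (p : M) (v w : TangentSpace 𝓘(ℝ, E) p), T p v w = T p w v

/-- The pull-back `f⋆α` of a covector field. -/
def CovecField.pullback (f : S → M) (α : CovecField E M) : CovecField F S :=
  fun q ↦ (α (f q)) ∘L (mfderiv 𝓘(ℝ, F) 𝓘(ℝ, E) f q)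

/-- The pull-back `f⋆T` of a 2-covariant tensor field. -/
def FormField.pullback (f : S → M) (T : FormField E M) : FormField F S :=
  fun q ↦ bilinComp (T (f q)) (mfderiv 𝓘(ℝ, F) 𝓘(ℝ, E) f q) (mfderiv 𝓘(ℝ, F) 𝓘(ℝ, E) f q)

/-- The differential `df` of a scalar function. -/
def differential (f : M → ℝ) : CovecField E M := fun p ↦ mvfderiv 𝓘(ℝ, E) f p

/-- The exterior derivative of a 1-form on a vector space,
`(dα)(v, w) = ∂ᵥ(α(w)) - ∂_w(α(v))` for constant `v, w`. -/
def flatExtDeriv (α : E → E →L[ℝ] ℝ) (y : E) : E →L[ℝ] E →L[ℝ] ℝ :=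
  fderiv ℝ α y - (fderiv ℝ α y).flip

/-- The Lie derivative of a 2-covariant tensor field on a vector space,
`(£_X T)(v, w) = (∂_X T)(v, w) + T(∂ᵥX, w) + T(v, ∂_w X)`, i.e. in components
`(£_X T)_{ab} = X^c ∂_c T_{ab} + T_{cb} ∂_a X^c + T_{ac} ∂_b X^c`. -/
def flatLieDeriv (X : E → E) (T : E → E →L[ℝ] E →L[ℝ] ℝ) (y : E) : E →L[ℝ] E →L[ℝ] ℝ :=
  fderiv ℝ T y (X y)
    + bilinComp (T y) (fderiv ℝ X y) (ContinuousLinearMap.id ℝ E)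
    + bilinComp (T y) (ContinuousLinearMap.id ℝ E) (fderiv ℝ X y)

/-- The representative in the preferred chart at `p` of a covector field. -/
def CovecField.inChart (p : M) (α : CovecField E M) : E → E →L[ℝ] ℝ :=
  CovecField.pullback (F := E) (S := E) (extChartAt 𝓘(ℝ, E) p).symm α

/-- The representative in the preferred chart at `p` of a 2-covariant tensor field. -/
def FormField.inChart (p : M) (T : FormField E M) : E → E →L[ℝ] E →L[ℝ] ℝ :=
  FormField.pullback (F := E) (S := E) (extChartAt 𝓘(ℝ, E) p).symm T

/-- The representative in the preferred chart at `p` of a vector field. -/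
def VecField.inChart (p : M) (X : VecField E M) : E → E :=
  VectorField.mpullback 𝓘(ℝ, E) 𝓘(ℝ, E) (extChartAt 𝓘(ℝ, E) p).symm X

/-- The 2-covariant tensor at `p` whose expression in the preferred chart at `p` is `B`. -/
def formOfChart (p : M) (B : E →L[ℝ] E →L[ℝ] ℝ) :
    TangentSpace 𝓘(ℝ, E) p →L[ℝ] TangentSpace 𝓘(ℝ, E) p →L[ℝ] ℝ :=
  let L : TangentSpace 𝓘(ℝ, E) p →L[ℝ] E :=
    mfderiv 𝓘(ℝ, E) 𝓘(ℝ, E) (extChartAt 𝓘(ℝ, E) p) p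
  bilinComp B L L

/-- The exterior derivative `dα` of a 1-form on a manifold, computed at each point in the preferred
chart there. -/
def extDeriv (α : CovecField E M) : FormField E M := fun p ↦
  formOfChart p (flatExtDeriv (α.inChart p) (extChartAt 𝓘(ℝ, E) p p))

/-- The Lie derivative `£_X T` of a 2-covariant tensor field on a manifold, computed at each point
in the preferred chart there. -/
def lieDeriv (X : VecField E M) (T : FormField E M) : FormField E M := fun p ↦
  formOfChart p (flatLieDeriv (X.inChart p) (T.inChart p) (extChartAt 𝓘(ℝ, E) p p))

end Fields

/-! ### Hypersurface data -/

section Data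

variable {E : Type*} [NormedAddCommGroup E] [NormedSpace ℝ E]
variable {N : Type*} [TopologicalSpace N] [ChartedSpace E N]
variable {F : Type*} [NormedAddCommGroup F] [NormedSpace ℝ F]
variable {S : Type*} [TopologicalSpace S] [ChartedSpace F S]

variable (E N) in
/-- A quadruple `{γ, ℓ, ℓ⁽²⁾, Y}` of fields on `N`: two 2-covariant tensors, a covector
and a scalar, with no conditions imposed yet. -/
structure Tuple where
  /-- the tensor `γ` -/
  gam : FormField E N
  /-- the covector `ℓ` -/
  ell : CovecField E N
  /-- the scalar `ℓ⁽²⁾` -/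
  ell2 : N → ℝ
  /-- the tensor `Y` -/
  Y : FormField E N

namespace Tuple

variable (D : Tuple E N)

/-- The symmetric form `𝑨|ₚ((W,a),(Z,b)) = γ(W,Z) + a ℓ(Z) + b ℓ(W) + a b ℓ⁽²⁾` on `TₚN × ℝ`. -/
def ambient (p : N) :
    (TangentSpace 𝓘(ℝ, E) p × ℝ) →L[ℝ] (TangentSpace 𝓘(ℝ, E) p × ℝ) →L[ℝ] ℝ :=
  let fstp := ContinuousLinearMap.fst ℝ (TangentSpace 𝓘(ℝ, E) p) ℝ
  let sndp := ContinuousLinearMap.snd ℝ (TangentSpace 𝓘(ℝ, E) p) ℝ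
  bilinComp (D.gam p) fstp fstp + sndp.smulRight (D.ell p ∘L fstp)
    + (D.ell p ∘L fstp).smulRight sndp + D.ell2 p • sndp.smulRight sndp

theorem ambient_apply (p : N) (W Z : TangentSpace 𝓘(ℝ, E) p) (a b : ℝ) :
    D.ambient p (W, a) (Z, b)
      = D.gam p W Z + a * D.ell p Z + b * D.ell p W + a * b * D.ell2 p := by
  simp [ambient]; ring

/-- The pair `(n, n⁽²⁾)` at `p`. It is the contraction of the inverse of `𝑨|ₚ` with the covector
`(0, 1)` on `TₚN × ℝ`, i.e. the unique pair with `𝑨|ₚ((n, n⁽²⁾), (Z, b)) = b` for all `(Z, b)`. -/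
def normalPair (p : N) : TangentSpace 𝓘(ℝ, E) p × ℝ :=
  (D.ambient p).inverse (ContinuousLinearMap.snd ℝ (TangentSpace 𝓘(ℝ, E) p) ℝ)

/-- Where `𝑨|ₚ` is non-degenerate, `(n, n⁽²⁾)` satisfies `γ(n, ·) + n⁽²⁾ ℓ = 0` and
`ℓ(n) + n⁽²⁾ ℓ⁽²⁾ = 1`. -/
theorem ambient_normalPair [FiniteDimensional ℝ E] (p : N)
    (hp : ∀ x, (∀ y, D.ambient p x y = 0) → x = 0) :
    D.gam p (D.normalPair p).1 + (D.normalPair p).2 • D.ell p = 0 ∧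
      D.ell p (D.normalPair p).1 + (D.normalPair p).2 * D.ell2 p = 1 := by
  have : FiniteDimensional ℝ (TangentSpace 𝓘(ℝ, E) p) := ‹FiniteDimensional ℝ E›
  have : T2Space (TangentSpace 𝓘(ℝ, E) p) := inferInstanceAs (T2Space E)
  have key := apply_inverse_of_nondegenerate (D.ambient p) hp
    (ContinuousLinearMap.snd ℝ (TangentSpace 𝓘(ℝ, E) p) ℝ)
  have key' : ∀ (Z : TangentSpace 𝓘(ℝ, E) p) (b : ℝ),
      D.ambient p ((D.normalPair p).1, (D.normalPair p).2) (Z, b) = b := fun Z b ↦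
    congrArg (fun f ↦ f (Z, b)) key
  constructor
  · ext Z
    have := key' Z 0
    rw [ambient_apply] at this
    simpa using this
  · have := key' 0 1
    rw [ambient_apply] at this
    simpa using this

/-- The vector field `n`. -/
def n : VecField E N := fun p ↦ (D.normalPair p).1

/-- The scalar `n⁽²⁾`. -/
def n2 : N → ℝ := fun p ↦ (D.normalPair p).2

/-- `{N, γ, ℓ, ℓ⁽²⁾, Y}` is hypersurface data: the fields are smooth, `γ` and `Y` are symmetric and
`𝑨` is non-degenerate at each point. -/
structure IsHypersurfaceData [IsManifold 𝓘(ℝ, E) ∞ N] : Prop where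
  gam_smooth : D.gam.Smooth
  ell_smooth : D.ell.Smooth
  ell2_smooth : ContMDiff 𝓘(ℝ, E) 𝓘(ℝ, ℝ) ∞ D.ell2
  Y_smooth : D.Y.Smooth
  gam_symm : D.gam.Symmetric
  Y_symm : D.Y.Symmetric
  nondegenerate : ∀ (p : N) (x : TangentSpace 𝓘(ℝ, E) p × ℝ),
    (∀ y, D.ambient p x y = 0) → x = 0

/-- Null hypersurface data: hypersurface data with `n⁽²⁾ = 0` everywhere. -/
structure IsNullHypersurfaceData [IsManifold 𝓘(ℝ, E) ∞ N] : Prop extends D.IsHypersurfaceData where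
  null : ∀ p : N, D.n2 p = 0

/-- The 2-form `F = ½ dℓ`. -/
def twoForm : FormField E N := fun p ↦ (1 / 2 : ℝ) • extDeriv D.ell p

/-- The covector `s = F(n, ·)`. -/
def s : CovecField E N := fun p ↦ D.twoForm p (D.n p)

/-- The covector `r = Y(n, ·)`. -/
def r : CovecField E N := fun p ↦ D.Y p (D.n p)

/-- The tensor `U = ½ £ₙγ + ℓ ⊗ₛ dn⁽²⁾`. -/
def U : FormField E N := fun p ↦
  (1 / 2 : ℝ) • lieDeriv D.n D.gam p + symProd (D.ell p) (differential D.n2 p)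

/-- The gauge transformation with gauge parameters `z` (a nowhere zero function) and `V`
(a vector field). -/
def gauge (z : N → ℝ) (V : VecField E N) : Tuple E N where
  gam := D.gam
  ell := fun p ↦ z p • (D.ell p + D.gam p (V p))
  ell2 := fun p ↦ z p ^ 2 * (D.ell2 p + 2 * D.ell p (V p) + D.gam p (V p) (V p))
  Y := fun p ↦ z p • D.Y p + symProd (D.ell p) (differential z p)
    + (1 / 2 : ℝ) • lieDeriv (fun q ↦ z q • V q) D.gam p

variable (F) in
/-- `ψ : S → N` is a smooth embedding and `n` is everywhere transverse to `ψ(S)`. -/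
structure IsTransverse (ψ : S → N) : Prop where
  embedding : Manifold.IsSmoothEmbedding 𝓘(ℝ, F) 𝓘(ℝ, E) ∞ ψ
  transverse : ∀ q : S, D.n (ψ q) ∉ Set.range (mfderiv 𝓘(ℝ, F) 𝓘(ℝ, E) ψ q)

variable (F) (ψ : S → N)

/-- The induced metric `h = ψ⋆γ`. -/
def h : FormField F S := D.gam.pullback ψ

/-- The covector `ℓ_∥ = ψ⋆ℓ`. -/
def ellPar : CovecField F S := D.ell.pullback ψ

/-- The tensor `U_∥ = ψ⋆U`. -/
def UPar : FormField F S := D.U.pullback ψ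

/-- The vector field `ℓ_∥^♯ = h^♯(ℓ_∥, ·)` on `S`, i.e. the vector field with `h(ℓ_∥^♯, ·) = ℓ_∥`. -/
def ellSharp : VecField F S := fun q ↦ (D.h F ψ q).inverse (D.ellPar F ψ q)

/-- The scalar `ℓ⁽²⁾_∥ = h^♯(ℓ_∥, ℓ_∥)` on `S`. -/
def ell2Par : S → ℝ := fun q ↦ D.ellPar F ψ q (D.ellSharp F ψ q)

/-- The covector `ω_∥ = ψ⋆(s - r) - U_∥(ℓ_∥^♯, ·)` on `S`. -/
def omega : CovecField F S := fun q ↦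
  CovecField.pullback ψ (fun p ↦ D.s p - D.r p) q - D.UPar F ψ q (D.ellSharp F ψ q)

/-- The tensor `𝔓_∥ = ψ⋆Y + ½ (ℓ⁽²⁾_∥ - ℓ⁽²⁾|_S) U_∥ - ½ £_{ℓ_∥^♯} h` on `S`. -/
def sec : FormField F S := fun q ↦
  D.Y.pullback ψ q + ((1 / 2 : ℝ) * (D.ell2Par F ψ q - D.ell2 (ψ q))) • D.UPar F ψ q
    - (1 / 2 : ℝ) • lieDeriv (D.ellSharp F ψ) (D.h F ψ) q

end Tuple

end Data

end HypersurfaceData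

end

open scoped Topology

noncomputable section

namespace HypersurfaceData

/-! ### Lie and exterior derivatives on a vector space -/

section Flat

variable {E : Type*} [NormedAddCommGroup E] [NormedSpace ℝ E]
variable {F : Type*} [NormedAddCommGroup F] [NormedSpace ℝ F]

/-! For null data `γ(n, ·) = 0` and `ℓ(n) = 1`, and `n` spans the radical of `γ`. A gauge
transformation turns `n` into `z⁻¹ n`, keeps `n⁽²⁾ = 0`, and turns `U` into `z⁻¹ U`, because the
Leibniz terms of `£_{z⁻¹n} γ` contain `γ(n, ·)`. Since also `U(n, ·) = 0`, `U` does not see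
multiples of `n`.

Along `S`, transversality and the dimension count give `V = dψ(V_∥) + μ n`, where `V_∥` is the
`h`-dual of `ψ⋆(γ(V, ·))`; hence `ℓ_∥^♯` becomes `ẑ (ℓ_∥^♯ + V_∥)`. For `ω_∥`, a computation in one
chart (`gauge_s_sub_r`) shows that `s - r` changes by `-z⁻¹ dz + U(V, ·)`, and the last term pulls
back to `U_∥(V_∥, ·)`, which is exactly the change of `U_∥(ℓ_∥^♯, ·)`.

For `𝔓_∥` the main tool is `flatLieDeriv_pullback`, in its manifold form `lieDeriv_pullback`: as `n`
is in the radical of `γ`, `½ ψ⋆(£_{zV} γ) = ½ £_{ẑV_∥} h + ẑ μ U_∥`. The first term cancels against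
the change of `½ £_{ℓ_∥^♯} h`, which also absorbs `ℓ_∥ ⊗ₛ dẑ`. The second cancels against the change
of `½ (ℓ⁽²⁾_∥ - ℓ⁽²⁾) U_∥`, where the bracket becomes `ẑ² (ℓ⁽²⁾_∥ - ℓ⁽²⁾ - 2μ)`.

All derivatives are evaluated in the preferred chart at the point, where the tangent space is the
model space itself. The fields `n`, `ℓ_∥^♯` and `V_∥`, defined pointwise by inverting forms, are
differentiable in charts because they solve linear equations with differentiable coefficients. -/

theorem flatLieDeriv_apply (X : E → E) (T : E → E →L[ℝ] E →L[ℝ] ℝ) (y v w : E) :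
    flatLieDeriv X T y v w
      = fderiv ℝ T y (X y) v w + T y (fderiv ℝ X y v) w + T y v (fderiv ℝ X y w) := by
  simp [flatLieDeriv]

theorem flatExtDeriv_apply (α : E → E →L[ℝ] ℝ) (y v w : E) :
    flatExtDeriv α y v w = fderiv ℝ α y v w - fderiv ℝ α y w v := by
  simp [flatExtDeriv]

theorem flatLieDeriv_congr {X X' : E → E} {T T' : E → E →L[ℝ] E →L[ℝ] ℝ} {y : E}
    (hX : X =ᶠ[𝓝 y] X') (hT : T =ᶠ[𝓝 y] T') : flatLieDeriv X T y = flatLieDeriv X' T' y := by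
  simp only [flatLieDeriv, hX.fderiv_eq, hT.fderiv_eq, hX.eq_of_nhds, hT.eq_of_nhds]

/-- No regularity is needed: where `T` is not differentiable, `fderiv` takes the value `0`, which is
symmetric. Hence symmetry of Lie derivatives, and of `𝔓_∥`, holds without differentiability
hypotheses. -/
theorem fderiv_symm_form {T : E → F →L[ℝ] F →L[ℝ] ℝ} (hT : ∀ y v w, T y v w = T y w v)
    (y u : E) (v w : F) : fderiv ℝ T y u v w = fderiv ℝ T y u w v := by
  by_cases h : DifferentiableAt ℝ T y
  · have key : ∀ v w, fderiv ℝ T y u v w = fderiv ℝ (fun x ↦ T x v w) y u := fun v w ↦ by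
      rw [fderiv_clm_apply (h.clm_apply (differentiableAt_const v)) (differentiableAt_const w),
        fderiv_clm_apply h (differentiableAt_const v)]
      simp
    rw [key, key]
    simp only [hT _ v w]
  · simp [fderiv_zero_of_not_differentiableAt h]

theorem flatLieDeriv_symm {T : E → E →L[ℝ] E →L[ℝ] ℝ} (hT : ∀ y v w, T y v w = T y w v)
    (X : E → E) (y v w : E) : flatLieDeriv X T y v w = flatLieDeriv X T y w v := by
  rw [flatLieDeriv_apply, flatLieDeriv_apply, fderiv_symm_form hT, hT y _ w, hT y v]
  ring

/-- The two Leibniz terms vanish when `X` lies in the radical of a symmetric `T`, as for `n`; for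
`ℓ_∥^♯` and `h` they are the source of `2 ℓ_∥ ⊗ₛ dẑ`. -/
theorem flatLieDeriv_smul {f : E → ℝ} {X : E → E} {y : E} (T : E → E →L[ℝ] E →L[ℝ] ℝ)
    (hf : DifferentiableAt ℝ f y) (hX : DifferentiableAt ℝ X y) (v w : E) :
    flatLieDeriv (fun x ↦ f x • X x) T y v w
      = f y * flatLieDeriv X T y v w + fderiv ℝ f y v * T y (X y) w
        + fderiv ℝ f y w * T y v (X y) := by
  simp only [flatLieDeriv_apply, fderiv_fun_smul hf hX]
  simp
  ring

theorem flatLieDeriv_add {X X' : E → E} {y : E} (T : E → E →L[ℝ] E →L[ℝ] ℝ)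
    (hX : DifferentiableAt ℝ X y) (hX' : DifferentiableAt ℝ X' y) :
    flatLieDeriv (fun x ↦ X x + X' x) T y = flatLieDeriv X T y + flatLieDeriv X' T y := by
  ext v w
  simp only [flatLieDeriv_apply, fderiv_fun_add hX hX', _root_.add_apply, map_add]
  ring

theorem fderiv_form_apply {T : E → F →L[ℝ] F →L[ℝ] ℝ} {X : E → F} {y : E}
    (hT : DifferentiableAt ℝ T y) (hX : DifferentiableAt ℝ X y) (u : E) (w : F) :
    fderiv ℝ (fun x ↦ T x (X x)) y u w = fderiv ℝ T y u (X y) w + T y (fderiv ℝ X y u) w := by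
  rw [fderiv_clm_apply hT hX]
  simp [add_comm]

/-- Differentiating the statement that `n` lies in the radical of `T`. -/
theorem fderiv_radical {T : E → F →L[ℝ] F →L[ℝ] ℝ} {X : E → F} {y : E}
    (hT : DifferentiableAt ℝ T y) (hX : DifferentiableAt ℝ X y)
    (h : ∀ᶠ x in 𝓝 y, T x (X x) = 0) (u : E) (w : F) :
    T y (fderiv ℝ X y u) w = - fderiv ℝ T y u (X y) w := by
  have h0 : (fun x ↦ T x (X x)) =ᶠ[𝓝 y] fun _ ↦ 0 := h
  have := fderiv_form_apply hT hX u w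
  rw [h0.fderiv_eq] at this
  simp at this
  linarith

theorem flatExtDeriv_gauge {T : E → E →L[ℝ] E →L[ℝ] ℝ} {α : E → E →L[ℝ] ℝ} {z : E → ℝ}
    {X : E → E} {y : E} (hT : DifferentiableAt ℝ T y) (hα : DifferentiableAt ℝ α y)
    (hz : DifferentiableAt ℝ z y) (hX : DifferentiableAt ℝ X y) (v w : E) :
    flatExtDeriv (fun x ↦ z x • (α x + T x (X x))) y v w
      = z y * (flatExtDeriv α y v w
          + (fderiv ℝ T y v (X y) w + T y (fderiv ℝ X y v) w)
          - (fderiv ℝ T y w (X y) v + T y (fderiv ℝ X y w) v))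
        + fderiv ℝ z y v * (α y w + T y (X y) w) - fderiv ℝ z y w * (α y v + T y (X y) v) := by
  have hTX : DifferentiableAt ℝ (fun x ↦ T x (X x)) y := hT.clm_apply hX
  rw [flatExtDeriv_apply, flatExtDeriv_apply, fderiv_fun_smul hz (hα.fun_add hTX),
    fderiv_fun_add hα hTX]
  simp [fderiv_form_apply hT hX]
  ring

theorem differentiableAt_bilinComp {T : F → E →L[ℝ] E →L[ℝ] ℝ} {L : F → F →L[ℝ] E} {y : F}
    (hT : DifferentiableAt ℝ T y) (hL : DifferentiableAt ℝ L y) :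
    DifferentiableAt ℝ (fun x ↦ bilinComp (T x) (L x) (L x)) y := by
  have : DifferentiableAt ℝ (fun x ↦ (ContinuousLinearMap.compL ℝ F E ℝ).flip (L x)) y :=
    DifferentiableAt.clm_apply (H := (E →L[ℝ] ℝ) →L[ℝ] F →L[ℝ] ℝ)
      (differentiableAt_const (ContinuousLinearMap.compL ℝ F E ℝ).flip) hL
  exact DifferentiableAt.clm_comp this (hT.clm_comp hL)

/-- The Lie derivative along a vector field which, along the image of `f`, is `f`-related to `W`
up to a multiple of a field `n` in the radical of `T`. -/
theorem flatLieDeriv_pullback {T : E → E →L[ℝ] E →L[ℝ] ℝ} {X n : E → E} {W : F → F} {f : F → E}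
    {c : F → ℝ} {y : F}
    (hTs : ∀ x v w, T x v w = T x w v)
    (hT : DifferentiableAt ℝ T (f y)) (hX : DifferentiableAt ℝ X (f y))
    (hn : DifferentiableAt ℝ n (f y)) (hW : DifferentiableAt ℝ W y)
    (hf : ContDiffAt ℝ 2 f y)
    (hrad : ∀ᶠ x in 𝓝 (f y), T x (n x) = 0)
    (hrel : ∀ᶠ x in 𝓝 y, X (f x) = fderiv ℝ f x (W x) + c x • n (f x)) (v w : F) :
    flatLieDeriv X T (f y) (fderiv ℝ f y v) (fderiv ℝ f y w)
      = flatLieDeriv W (fun x ↦ bilinComp (T (f x)) (fderiv ℝ f x) (fderiv ℝ f x)) y v w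
        + c y * flatLieDeriv n T (f y) (fderiv ℝ f y v) (fderiv ℝ f y w) := by
  have hfd : DifferentiableAt ℝ f y := hf.differentiableAt (by norm_num)
  have hf' : DifferentiableAt ℝ (fderiv ℝ f) y :=
    (hf.fderiv_right (m := 1) (by norm_num)).differentiableAt (by norm_num)
  -- The second derivative of `f` enters as `D²f(u, W)` through the derivative of `df(W)` and as
  -- `D²f(W, u)` through the pulled-back form; symmetry identifies the two.
  have hsymm : ∀ u v, fderiv ℝ (fderiv ℝ f) y u v = fderiv ℝ (fderiv ℝ f) y v u := fun u v ↦
    (hf.isSymmSndFDerivAt (by simp)).eq u v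
  have hTf : DifferentiableAt ℝ (fun x ↦ T (f x)) y :=
    DifferentiableAt.comp (G := E →L[ℝ] E →L[ℝ] ℝ) (g := T) y hT hfd
  have hTf' : ∀ u, fderiv ℝ (fun x ↦ T (f x)) y u = fderiv ℝ T (f y) (fderiv ℝ f y u) := fun u ↦ by
    exact congrArg (fun L ↦ L u)
      (fderiv_comp (G := E →L[ℝ] E →L[ℝ] ℝ) (g := T) y hT hfd)
  -- the defect field
  have hXf : DifferentiableAt ℝ (fun x ↦ X (f x)) y := hX.comp y hfd
  have hXf' : ∀ u, fderiv ℝ (fun x ↦ X (f x)) y u = fderiv ℝ X (f y) (fderiv ℝ f y u) := fun u ↦ by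
    rw [show (fun x ↦ X (f x)) = X ∘ f from rfl, fderiv_comp y hX hfd]; rfl
  have hfW : DifferentiableAt ℝ (fun x ↦ fderiv ℝ f x (W x)) y := hf'.clm_apply hW
  have hfW' : ∀ u, fderiv ℝ (fun x ↦ fderiv ℝ f x (W x)) y u
      = fderiv ℝ (fderiv ℝ f) y u (W y) + fderiv ℝ f y (fderiv ℝ W y u) := fun u ↦ by
    rw [fderiv_clm_apply hf' hW]; simp [add_comm]
  -- Contracting with `T` before differentiating removes `c • n`, so `c` is never differentiated and
  -- needs no regularity.
  have hdef : ∀ᶠ x in 𝓝 y, T (f x) (X (f x) - fderiv ℝ f x (W x)) = 0 := by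
    filter_upwards [hrel, hfd.continuousAt.eventually hrad] with x hx hx'
    rw [hx]; simp [hx']
  have hX0 := hrel.self_of_nhds
  have key : ∀ u (e : E), T (f y) (fderiv ℝ X (f y) (fderiv ℝ f y u)) e
      = T (f y) (fderiv ℝ (fderiv ℝ f) y u (W y)) e + T (f y) (fderiv ℝ f y (fderiv ℝ W y u)) e
        + c y * T (f y) (fderiv ℝ n (f y) (fderiv ℝ f y u)) e := by
    -- `h1` expresses `T` of the derivative of the defect as `-c (DT)(n)`, and `h2` rewrites this as
    -- `c T(Dn)`.
    intro u e
    have h1 := fderiv_radical hTf (hXf.fun_sub hfW) hdef u e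
    have h2 := fderiv_radical hT hn hrad (fderiv ℝ f y u) e
    rw [fderiv_fun_sub hXf hfW, hTf', hX0] at h1
    simp only [_root_.sub_apply, hXf', hfW', map_sub, map_add, add_sub_cancel_left,
      map_smul, _root_.smul_apply, _root_.add_apply, smul_eq_mul] at h1
    rw [h2]; linarith
  -- the derivative of the pulled back form
  have hP : ∀ u v w, fderiv ℝ (fun x ↦ bilinComp (T (f x)) (fderiv ℝ f x) (fderiv ℝ f x)) y u v w
      = fderiv ℝ T (f y) (fderiv ℝ f y u) (fderiv ℝ f y v) (fderiv ℝ f y w)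
        + T (f y) (fderiv ℝ (fderiv ℝ f) y u v) (fderiv ℝ f y w)
        + T (f y) (fderiv ℝ f y v) (fderiv ℝ (fderiv ℝ f) y u w) := by
    intro u v w
    have hB : DifferentiableAt ℝ
        (fun x ↦ bilinComp (T (f x)) (fderiv ℝ f x) (fderiv ℝ f x)) y := 
      differentiableAt_bilinComp hTf hf'
    have e1 : fderiv ℝ (fun x ↦ T (f x) (fderiv ℝ f x v) (fderiv ℝ f x w)) y u
        = fderiv ℝ (fun x ↦ bilinComp (T (f x)) (fderiv ℝ f x) (fderiv ℝ f x)) y u v w := by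
      have a1 : DifferentiableAt ℝ
        (fun x ↦ bilinComp (T (f x)) (fderiv ℝ f x) (fderiv ℝ f x) v) y :=
        hB.clm_apply (differentiableAt_const v)
      have := fderiv_clm_apply a1 (differentiableAt_const w)
      simp only [bilinComp_apply] at this
      rw [this, fderiv_clm_apply hB (differentiableAt_const v)]
      simp
    have dv : DifferentiableAt ℝ (fun x ↦ fderiv ℝ f x v) y := hf'.clm_apply (differentiableAt_const v)
    have dw : DifferentiableAt ℝ (fun x ↦ fderiv ℝ f x w) y := hf'.clm_apply (differentiableAt_const w)
    have dv' : fderiv ℝ (fun x ↦ fderiv ℝ f x v) y u = fderiv ℝ (fderiv ℝ f) y u v := by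
      rw [fderiv_clm_apply hf' (differentiableAt_const v)]; simp
    have dw' : fderiv ℝ (fun x ↦ fderiv ℝ f x w) y u = fderiv ℝ (fderiv ℝ f) y u w := by
      rw [fderiv_clm_apply hf' (differentiableAt_const w)]; simp
    rw [← e1, fderiv_clm_apply (hTf.clm_apply dv) dw]
    simp only [_root_.add_apply, ContinuousLinearMap.comp_apply,
      ContinuousLinearMap.flip_apply, fderiv_form_apply hTf dv, dv', dw', hTf']
    ring
  have key' : ∀ u (e : E), T (f y) e (fderiv ℝ X (f y) (fderiv ℝ f y u))
      = T (f y) e (fderiv ℝ (fderiv ℝ f) y u (W y)) + T (f y) e (fderiv ℝ f y (fderiv ℝ W y u))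
        + c y * T (f y) e (fderiv ℝ n (f y) (fderiv ℝ f y u)) := fun u e ↦ by
    simpa only [hTs (f y) e] using key u e
  simp only [flatLieDeriv_apply, hP, bilinComp_apply, key, key', hX0, map_add, map_smul,
    _root_.add_apply, _root_.smul_apply, smul_eq_mul, hsymm (W y)]
  ring

end Flat

/-! ### Tensor fields in the preferred chart at a point -/

section Charts

variable {E : Type*} [NormedAddCommGroup E] [NormedSpace ℝ E]
variable {M : Type*} [TopologicalSpace M] [ChartedSpace E M]

/-- The derivative of the inverse of the preferred chart at `p`, as an endomorphism of the
model space. -/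
def chartSymmDeriv (p : M) (y : E) : E →L[ℝ] E :=
  mfderiv 𝓘(ℝ, E) 𝓘(ℝ, E) (extChartAt 𝓘(ℝ, E) p).symm y

theorem CovecField.inChart_apply (p : M) (α : CovecField E M) (y v : E) :
    α.inChart p y v = α ((extChartAt 𝓘(ℝ, E) p).symm y) (chartSymmDeriv p y v) := rfl

theorem FormField.inChart_apply (p : M) (T : FormField E M) (y v w : E) :
    T.inChart p y v w
      = T ((extChartAt 𝓘(ℝ, E) p).symm y) (chartSymmDeriv p y v) (chartSymmDeriv p y w) := rfl

theorem VecField.inChart_eq (p : M) (X : VecField E M) (y : E) :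
    X.inChart p y = (chartSymmDeriv p y).inverse (X ((extChartAt 𝓘(ℝ, E) p).symm y)) := rfl

theorem VecField.inChart_smul (p : M) (f : M → ℝ) (X : VecField E M) :
    VecField.inChart p (fun q ↦ f q • X q)
      = fun y ↦ f ((extChartAt 𝓘(ℝ, E) p).symm y) • X.inChart p y := by
  funext y
  exact map_smul (chartSymmDeriv p y).inverse _ (X ((extChartAt 𝓘(ℝ, E) p).symm y) : E)

theorem VecField.inChart_add (p : M) (X X' : VecField E M) :
    VecField.inChart p (fun q ↦ X q + X' q) = fun y ↦ X.inChart p y + X'.inChart p y := by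
  funext y
  exact map_add (chartSymmDeriv p y).inverse (X ((extChartAt 𝓘(ℝ, E) p).symm y) : E)
    (X' ((extChartAt 𝓘(ℝ, E) p).symm y) : E)

variable {G : Type*} [NormedAddCommGroup G] [NormedSpace ℝ G]

theorem differentiableAt_comp_chart_symm {f : M → G} {p : M}
    (hf : ContMDiffAt 𝓘(ℝ, E) 𝓘(ℝ, G) ∞ f p) :
    DifferentiableAt ℝ (fun y ↦ f ((extChartAt 𝓘(ℝ, E) p).symm y)) (extChartAt 𝓘(ℝ, E) p p) := by
  have h1 := contMDiffAt_iff.1 hf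
  have h2 := h1.2
  simp only [ModelWithCorners.range_eq_univ, contDiffWithinAt_univ] at h2
  exact h2.differentiableAt (by simp)

theorem chart_symm_mem_source {p : M} {y : E} (hy : y ∈ (extChartAt 𝓘(ℝ, E) p).target) :
    (extChartAt 𝓘(ℝ, E) p).symm y ∈ (chartAt E p).source := by
  have := (extChartAt 𝓘(ℝ, E) p).map_target hy
  rwa [extChartAt_source] at this

variable [IsManifold 𝓘(ℝ, E) ∞ M]

theorem isManifold_one : IsManifold 𝓘(ℝ, E) 1 M := IsManifold.of_le (n := ∞) (by norm_cast)

/-- The tangent space at `p` is identified with `E` through the preferred chart at `p`, so at the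
base point itself the chart has derivative the identity. -/
theorem chartSymmDeriv_self (p : M) :
    chartSymmDeriv p (extChartAt 𝓘(ℝ, E) p p) = ContinuousLinearMap.id ℝ E := by
  have := isManifold_one (E := E) (M := M)
  have h := mfderivWithin_range_extChartAt_symm (I := 𝓘(ℝ, E)) (x := p)
  rw [ModelWithCorners.range_eq_univ, mfderivWithin_univ] at h
  exact h

theorem isInvertible_chartSymmDeriv {p : M} {y : E} (hy : y ∈ (extChartAt 𝓘(ℝ, E) p).target) :
    (chartSymmDeriv p y).IsInvertible := by
  have := isManifold_one (E := E) (M := M)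
  have h := isInvertible_mfderivWithin_extChartAt_symm (I := 𝓘(ℝ, E)) hy
  rw [ModelWithCorners.range_eq_univ, mfderivWithin_univ] at h
  exact h

theorem chartSymmDeriv_inverse {p : M} {y : E} (hy : y ∈ (extChartAt 𝓘(ℝ, E) p).target) (v : E) :
    chartSymmDeriv p y ((chartSymmDeriv p y).inverse v) = v := by
  obtain ⟨e, he⟩ := isInvertible_chartSymmDeriv hy
  rw [← he]; simp

theorem chartSymmDeriv_injective {p : M} {y : E} (hy : y ∈ (extChartAt 𝓘(ℝ, E) p).target) :
    Function.Injective (chartSymmDeriv p y) := by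
  obtain ⟨e, he⟩ := isInvertible_chartSymmDeriv hy
  rw [← he]; exact e.injective

theorem chartSymmDeriv_surjective {p : M} {y : E} (hy : y ∈ (extChartAt 𝓘(ℝ, E) p).target) :
    Function.Surjective (chartSymmDeriv p y) := fun v ↦ ⟨_, chartSymmDeriv_inverse hy v⟩

theorem VecField.chartSymmDeriv_inChart {p : M} {y : E}
    (hy : y ∈ (extChartAt 𝓘(ℝ, E) p).target) (X : VecField E M) :
    chartSymmDeriv p y (X.inChart p y) = X ((extChartAt 𝓘(ℝ, E) p).symm y) :=
  chartSymmDeriv_inverse hy _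

theorem formOfChart_eq (p : M) (B : E →L[ℝ] E →L[ℝ] ℝ) : formOfChart p B = B := by
  have := isManifold_one (E := E) (M := M)
  have h := mfderiv_extChartAt_self (I := 𝓘(ℝ, E)) (x := p)
  unfold formOfChart
  rw [h]
  rfl

theorem lieDeriv_eq (X : VecField E M) (T : FormField E M) (p : M) :
    lieDeriv X T p = flatLieDeriv (X.inChart p) (T.inChart p) (extChartAt 𝓘(ℝ, E) p p) :=
  formOfChart_eq p _

theorem extDeriv_eq (α : CovecField E M) (p : M) :
    extDeriv α p = flatExtDeriv (α.inChart p) (extChartAt 𝓘(ℝ, E) p p) :=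
  formOfChart_eq p _

theorem VecField.inChart_self (p : M) (X : VecField E M) :
    X.inChart p (extChartAt 𝓘(ℝ, E) p p) = X p := by
  rw [VecField.inChart_eq, chartSymmDeriv_self, ContinuousLinearMap.inverse_id]
  exact congrArg (fun q ↦ (X q : E)) (extChartAt_to_inv p)

theorem CovecField.inChart_self (p : M) (α : CovecField E M) :
    α.inChart p (extChartAt 𝓘(ℝ, E) p p) = α p := by
  ext v
  rw [CovecField.inChart_apply, chartSymmDeriv_self]
  exact congrArg (fun q ↦ (α q : E →L[ℝ] ℝ) v) (extChartAt_to_inv p)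

theorem FormField.inChart_self (p : M) (T : FormField E M) :
    T.inChart p (extChartAt 𝓘(ℝ, E) p p) = T p := by
  ext v w
  rw [FormField.inChart_apply, chartSymmDeriv_self]
  exact congrArg (fun q ↦ (T q : E →L[ℝ] E →L[ℝ] ℝ) v w) (extChartAt_to_inv p)

theorem CovecField.inChart_gauge (p : M) {y : E} (hy : y ∈ (extChartAt 𝓘(ℝ, E) p).target)
    (z : M → ℝ) (α : CovecField E M) (T : FormField E M) (X : VecField E M) :
    CovecField.inChart p (fun q ↦ z q • (α q + T q (X q))) y
      = z ((extChartAt 𝓘(ℝ, E) p).symm y) • (α.inChart p y + T.inChart p y (X.inChart p y)) := by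
  ext v
  simp only [smul_apply, add_apply, CovecField.inChart_apply, FormField.inChart_apply,
    X.chartSymmDeriv_inChart hy]
  rfl

/-- The bridge from smoothness of sections, expressed by trivializations of the tangent bundle, to
differentiability of `inChart`, expressed by the derivative of the inverse chart. -/
theorem symmL_eq_chartSymmDeriv {p : M} {y : E} (hy : y ∈ (extChartAt 𝓘(ℝ, E) p).target) (v : E) :
    (trivializationAt E (TangentSpace 𝓘(ℝ, E)) p).symm ((extChartAt 𝓘(ℝ, E) p).symm y) v
      = chartSymmDeriv p y v := by
  have := isManifold_one (E := E) (M := M)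
  have h := TangentBundle.symmL_trivializationAt (I := 𝓘(ℝ, E)) (chart_symm_mem_source hy)
  rw [ModelWithCorners.range_eq_univ, mfderivWithin_univ,
    (extChartAt 𝓘(ℝ, E) p).right_inv hy] at h
  exact (Bundle.Trivialization.symmL_apply _ (by simpa using chart_symm_mem_source hy) v).symm.trans
     (congrArg (fun L : E →L[ℝ] E ↦ L v) h)

theorem FormField.Smooth.differentiableAt_inChart {T : FormField E M} (hT : T.Smooth) (p : M) :
    DifferentiableAt ℝ (T.inChart p) (extChartAt 𝓘(ℝ, E) p p) := by
  have h1 := ((contMDiffAt_hom_bundle _).1 (hT p)).2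
  have h2 := differentiableAt_comp_chart_symm h1
  refine h2.congr_of_eventuallyEq ?_
  filter_upwards [extChartAt_target_mem_nhds (I := 𝓘(ℝ, E)) p] with y hy
  ext v w
  have hs := chart_symm_mem_source hy
  rw [inCoordinates_apply_eq₂ (by simpa using hs) (by simpa using hs) (by simp)]
  rw [symmL_eq_chartSymmDeriv hy, symmL_eq_chartSymmDeriv hy]
  simp
  rfl

theorem CovecField.Smooth.differentiableAt_inChart {α : CovecField E M} (hα : α.Smooth) (p : M) :
    DifferentiableAt ℝ (α.inChart p) (extChartAt 𝓘(ℝ, E) p p) := by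
  have h1 := ((contMDiffAt_hom_bundle _).1 (hα p)).2
  have h2 := differentiableAt_comp_chart_symm h1
  refine h2.congr_of_eventuallyEq ?_
  filter_upwards [extChartAt_target_mem_nhds (I := 𝓘(ℝ, E)) p] with y hy
  ext v
  have hs := chart_symm_mem_source hy
  rw [CovecField.inChart_apply, ← symmL_eq_chartSymmDeriv hy, ContinuousLinearMap.inCoordinates,
    show Bundle.Trivialization.continuousLinearMapAt ℝ (trivializationAt ℝ (fun _ : M ↦ ℝ) p)
        ((extChartAt 𝓘(ℝ, E) p).symm y) = ContinuousLinearMap.id ℝ ℝ from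
      Bundle.Trivial.continuousLinearMapAt_trivialization ℝ M ℝ _,
    ← Bundle.Trivialization.symmL_apply (R := ℝ) _ (by simpa using hs)]
  rfl

theorem VecField.Smooth.differentiableAt_inChart [CompleteSpace E] {X : VecField E M}
    (hX : X.Smooth) (p : M) :
    DifferentiableAt ℝ (X.inChart p) (extChartAt 𝓘(ℝ, E) p p) := by
  have h := VectorField.contMDiffWithinAt_mpullbackWithin_extChartAt_symm (I := 𝓘(ℝ, E)) (n := ∞) (m := ∞)
    (s := Set.univ) (hX p).contMDiffWithinAt uniqueMDiffOn_univ (Set.mem_univ p) (by simp)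
  simp only [ModelWithCorners.range_eq_univ, VectorField.mpullbackWithin_univ, Set.preimage_univ,
    Set.inter_univ] at h
  have h2 := h.contMDiffAt (extChartAt_target_mem_nhds (I := 𝓘(ℝ, E)) p)
  have h3 := (contMDiffAt_vectorSpace_iff_contDiffAt).1 h2
  exact h3.differentiableAt (by simp)

end Charts

/-! ### Inverting non-degenerate forms depending on a parameter -/

section Linear

variable {E : Type*} [NormedAddCommGroup E] [NormedSpace ℝ E]

theorem isInvertible_of_nondegenerate [FiniteDimensional ℝ E] (B : E →L[ℝ] E →L[ℝ] ℝ)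
    (hB : ∀ x, (∀ y, B x y = 0) → x = 0) : B.IsInvertible := by
  have hinj : Function.Injective (B : E →ₗ[ℝ] (E →L[ℝ] ℝ)) := by
    rw [← LinearMap.ker_eq_bot, LinearMap.ker_eq_bot']
    intro x hx
    refine hB x fun y ↦ ?_
    have : B x = 0 := hx
    simp [this]
  have hdim : Module.finrank ℝ E = Module.finrank ℝ (E →L[ℝ] ℝ) := by
    rw [← (LinearMap.toContinuousLinearMap (𝕜 := ℝ) (E := E) (F' := ℝ)).finrank_eq]
    exact Subspace.dual_finrank_eq.symm
  exact ⟨(LinearEquiv.ofInjectiveOfFinrankEq (B : E →ₗ[ℝ] (E →L[ℝ] ℝ)) hinj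
    hdim).toContinuousLinearEquiv, by ext x y; rfl⟩

theorem inverse_apply_eq_of_isInvertible {G : Type*} [NormedAddCommGroup G] [NormedSpace ℝ G]
    {B : E →L[ℝ] G} (hB : B.IsInvertible) {x : E} {α : G} (h : B x = α) :
    B.inverse α = x := by
  obtain ⟨e, rfl⟩ := hB
  rw [← h]; simp

theorem apply_inverse_of_isInvertible {G : Type*} [NormedAddCommGroup G] [NormedSpace ℝ G]
    {B : E →L[ℝ] G} (hB : B.IsInvertible) (α : G) : B (B.inverse α) = α := by
  obtain ⟨e, rfl⟩ := hB
  simp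

/-- Differentiability of the solution of a linear equation with differentiable coefficients. -/
theorem differentiableAt_inverse_apply [CompleteSpace E] {G F : Type*}
    [NormedAddCommGroup G] [NormedSpace ℝ G] [NormedAddCommGroup F] [NormedSpace ℝ F]
    {B : F → E →L[ℝ] G} {α : F → G} {y : F} (hy : (B y).IsInvertible)
    (hB : DifferentiableAt ℝ B y) (hα : DifferentiableAt ℝ α y) :
    DifferentiableAt ℝ (fun x ↦ (B x).inverse (α x)) y := by
  have h1 : DifferentiableAt ℝ (ContinuousLinearMap.inverse : (E →L[ℝ] G) → (G →L[ℝ] E)) (B y) :=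
    (hy.contDiffAt_map_inverse (n := 1)).differentiableAt (by norm_num)
  have h2 : DifferentiableAt ℝ (fun x ↦ (B x).inverse) y :=
    DifferentiableAt.comp (G := G →L[ℝ] E) (g := ContinuousLinearMap.inverse) y h1 hB
  exact h2.clm_apply hα

/-- The form `((W, a), (Z, b)) ↦ B (W, Z) + a α(Z) + b α(W) + a b c` on `E × ℝ`. -/
def borderedForm (B : E →L[ℝ] E →L[ℝ] ℝ) (α : E →L[ℝ] ℝ) (c : ℝ) :
    (E × ℝ) →L[ℝ] (E × ℝ) →L[ℝ] ℝ :=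
  let fstp := ContinuousLinearMap.fst ℝ E ℝ
  let sndp := ContinuousLinearMap.snd ℝ E ℝ
  bilinComp B fstp fstp + sndp.smulRight (α ∘L fstp)
    + (α ∘L fstp).smulRight sndp + c • sndp.smulRight sndp

theorem borderedForm_apply (B : E →L[ℝ] E →L[ℝ] ℝ) (α : E →L[ℝ] ℝ) (c : ℝ) (x y : E × ℝ) :
    borderedForm B α c x y = B x.1 y.1 + x.2 * α y.1 + y.2 * α x.1 + x.2 * y.2 * c := by
  simp [borderedForm]; ring

set_option maxSynthPendingDepth 5 in
theorem differentiableAt_borderedForm {F : Type*} [NormedAddCommGroup F] [NormedSpace ℝ F]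
    {B : F → E →L[ℝ] E →L[ℝ] ℝ} {α : F → E →L[ℝ] ℝ} {c : F → ℝ} {y : F}
    (hB : DifferentiableAt ℝ B y) (hα : DifferentiableAt ℝ α y) (hc : DifferentiableAt ℝ c y) :
    DifferentiableAt ℝ (fun x ↦ borderedForm (B x) (α x) (c x)) y := by
  let fstp := ContinuousLinearMap.fst ℝ E ℝ
  let sndp := ContinuousLinearMap.snd ℝ E ℝ
  have hcomp : DifferentiableAt ℝ (fun x ↦ (α x) ∘L fstp) y :=
    hα.clm_comp (differentiableAt_const fstp)
  have h1 : DifferentiableAt ℝ (fun x ↦ bilinComp (B x) fstp fstp) y :=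
    DifferentiableAt.clm_comp (differentiableAt_const (ContinuousLinearMap.precomp ℝ fstp))
      (hB.clm_comp (differentiableAt_const fstp))
  have h2 : DifferentiableAt ℝ (fun x ↦ sndp.smulRight ((α x) ∘L fstp)) y :=
    DifferentiableAt.clm_apply (H := (E × ℝ) →L[ℝ] (E × ℝ) →L[ℝ] ℝ)
      (differentiableAt_const (ContinuousLinearMap.smulRightL ℝ (E × ℝ) ((E × ℝ) →L[ℝ] ℝ) sndp))
      hcomp
  have h3 : DifferentiableAt ℝ (fun x ↦ ((α x) ∘L fstp).smulRight sndp) y :=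
    DifferentiableAt.clm_apply (H := (E × ℝ) →L[ℝ] (E × ℝ) →L[ℝ] ℝ)
      (differentiableAt_const
        ((ContinuousLinearMap.smulRightL ℝ (E × ℝ) ((E × ℝ) →L[ℝ] ℝ)).flip sndp))
      hcomp
  have h4 : DifferentiableAt ℝ (fun x ↦ c x • sndp.smulRight sndp) y :=
    hc.smul_const _
  exact ((h1.fun_add h2).fun_add h3).fun_add h4

end Linear

/-! ### Null data: the field `n`, its gauge behaviour and its differentiability -/

section Data

variable {E : Type*} [NormedAddCommGroup E] [NormedSpace ℝ E]
variable {N : Type*} [TopologicalSpace N] [ChartedSpace E N]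

theorem differential_eq {f : N → ℝ} {p : N} (hf : MDifferentiableAt 𝓘(ℝ, E) 𝓘(ℝ, ℝ) f p) :
    differential (E := E) f p
      = fderiv ℝ (fun y ↦ f ((extChartAt 𝓘(ℝ, E) p).symm y)) (extChartAt 𝓘(ℝ, E) p p) := by
  have h := hf.mfderiv
  rw [ModelWithCorners.range_eq_univ, fderivWithin_univ] at h
  ext v
  exact congrArg (fun L : E →L[ℝ] ℝ ↦ L v) h

theorem differential_zero (p : N) : differential (E := E) (fun _ : N ↦ (0 : ℝ)) p = 0 :=
  mvfderiv_const 0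

namespace Tuple

variable {D : Tuple E N}

theorem normalPair_eq [FiniteDimensional ℝ E] {p : N}
    (hp : ∀ x, (∀ y, D.ambient p x y = 0) → x = 0) {x : E × ℝ}
    (hx : ∀ (Z : E) (b : ℝ), D.ambient p x (Z, b) = b) : D.normalPair p = x := by
  refine inverse_apply_eq_of_isInvertible (E := E × ℝ) (G := (E × ℝ) →L[ℝ] ℝ)
    (isInvertible_of_nondegenerate (E := E × ℝ) _ hp) ?_
  ext v
  · exact hx _ _
  · exact hx _ _

theorem U_eq_of_null (h : ∀ p, D.n2 p = 0) (p : N) :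
    D.U p = (1 / 2 : ℝ) • lieDeriv D.n D.gam p := by
  have : D.n2 = fun _ ↦ 0 := funext h
  ext v w
  simp [U, this, differential_zero]

variable [IsManifold 𝓘(ℝ, E) ∞ N]

variable [FiniteDimensional ℝ E]

theorem IsNullHypersurfaceData.gam_n (hD : D.IsNullHypersurfaceData) (p : N) :
    D.gam p (D.n p) = 0 := by
  have := (D.ambient_normalPair p (hD.nondegenerate p)).1
  rw [show (D.normalPair p).2 = 0 from hD.null p, zero_smul, add_zero] at this
  exact this

theorem IsNullHypersurfaceData.ell_n (hD : D.IsNullHypersurfaceData) (p : N) :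
    D.ell p (D.n p) = 1 := by
  have := (D.ambient_normalPair p (hD.nondegenerate p)).2
  rw [show (D.normalPair p).2 = 0 from hD.null p, zero_mul, add_zero] at this
  exact this

/-- Subtracting `ℓ(x) n` from `x` makes `ℓ` vanish on it as well, so that paired with `0` it lies in
the radical of `𝑨`, which is trivial. -/
theorem IsNullHypersurfaceData.eq_smul_n (hD : D.IsNullHypersurfaceData) {p : N}
    {x : TangentSpace 𝓘(ℝ, E) p} (hx : ∀ w, D.gam p x w = 0) : x = D.ell p x • D.n p := by
  have h := hD.nondegenerate p (x - D.ell p x • D.n p, 0) fun y ↦ by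
    rw [← Prod.mk.eta (p := y), D.ambient_apply]
    simp [hx, hD.gam_n, hD.ell_n]
  exact sub_eq_zero.1 (congrArg Prod.fst h)

/-- The isomorphism `(W, a) ↦ (W + a z V, z a)` pulls `𝑨` back to the transformed form. The latter
is therefore non-degenerate, and it suffices to check that the claimed pair solves the defining
equation. -/
theorem IsNullHypersurfaceData.gauge_normalPair (hD : D.IsNullHypersurfaceData) {z : N → ℝ}
    (hz0 : ∀ p, z p ≠ 0) (V : VecField E N) (p : N) :
    (D.gauge z V).normalPair p = ((z p)⁻¹ • D.n p, 0) := by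
  have hz := hz0 p
  refine normalPair_eq ?_ ?_
  · rintro ⟨W, a⟩ h
    have key := hD.nondegenerate p (W + (a * z p) • V p, z p * a) ?_
    · rw [Prod.mk_eq_zero] at key
      obtain ⟨h1, h2⟩ := key
      have ha : a = 0 := by simpa [hz] using h2
      subst ha
      simpa using h1
    · rintro ⟨Z, b⟩
      -- The test vector is the preimage of `(Z, b)` under the isomorphism.
      have h1 := h (Z - b • V p, (z p)⁻¹ * b)
      rw [ambient_apply] at h1 ⊢
      rw [← h1]
      simp only [gauge, map_add, map_sub, map_smul, smul_apply, add_apply, smul_eq_mul,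
        hD.gam_symm p (V p)]
      field_simp
      ring
  · intro Z b
    refine (ambient_apply _ _ _ _ _ _).trans ?_
    simp [gauge, hD.gam_n, hD.ell_n, hD.gam_symm p (V p), hz]
    rfl

theorem IsNullHypersurfaceData.gauge_n (hD : D.IsNullHypersurfaceData) {z : N → ℝ}
    (hz0 : ∀ p, z p ≠ 0) (V : VecField E N) :
    (D.gauge z V).n = fun p ↦ (z p)⁻¹ • D.n p :=
  funext fun p ↦ congrArg Prod.fst (hD.gauge_normalPair hz0 V p)

theorem IsNullHypersurfaceData.gam_inChart_n (hD : D.IsNullHypersurfaceData) {p : N} {y : E}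
    (hy : y ∈ (extChartAt 𝓘(ℝ, E) p).target) : D.gam.inChart p y (D.n.inChart p y) = 0 := by
  ext w
  rw [FormField.inChart_apply, VecField.chartSymmDeriv_inChart hy, hD.gam_n]
  rfl

theorem IsNullHypersurfaceData.eventually_gam_inChart_n (hD : D.IsNullHypersurfaceData) (p : N) :
    ∀ᶠ y in 𝓝 (extChartAt 𝓘(ℝ, E) p p), D.gam.inChart p y (D.n.inChart p y) = 0 := by
  filter_upwards [extChartAt_target_mem_nhds (I := 𝓘(ℝ, E)) p] with y hy using hD.gam_inChart_n hy

/-- In the chart, `(n, 0)` solves the linear system whose matrix is the chart expression of `𝑨`;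
this matrix is differentiable at the centre and invertible throughout the chart target, so the
solution is differentiable. -/
theorem IsNullHypersurfaceData.differentiableAt_inChart_n (hD : D.IsNullHypersurfaceData) (p : N) :
    DifferentiableAt ℝ (D.n.inChart p) (extChartAt 𝓘(ℝ, E) p p) := by
  set A : E → (E × ℝ) →L[ℝ] (E × ℝ) →L[ℝ] ℝ := fun y ↦ borderedForm (D.gam.inChart p y)
    (D.ell.inChart p y) (D.ell2 ((extChartAt 𝓘(ℝ, E) p).symm y)) with hA
  have hAd : DifferentiableAt ℝ A (extChartAt 𝓘(ℝ, E) p p) :=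
    differentiableAt_borderedForm (hD.gam_smooth.differentiableAt_inChart p)
      (hD.ell_smooth.differentiableAt_inChart p) (differentiableAt_comp_chart_symm (hD.ell2_smooth p))
  -- The chart derivative is a bijection on the tangent factor, so non-degeneracy of `𝑨` carries
  -- over.
  have hAi : ∀ y ∈ (extChartAt 𝓘(ℝ, E) p).target, (A y).IsInvertible := by
    refine fun y hy ↦ isInvertible_of_nondegenerate _ fun x hx ↦ ?_
    obtain ⟨W, hW⟩ : ∃ W : TangentSpace 𝓘(ℝ, E) ((extChartAt 𝓘(ℝ, E) p).symm y),
      W = chartSymmDeriv p y x.1 := ⟨_, rfl⟩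
    have h0 : (W, x.2) = 0 := by
      refine hD.nondegenerate _ _ ?_
      rintro ⟨Z, b⟩
      obtain ⟨Z', hZ'⟩ := chartSymmDeriv_surjective hy Z
      rw [ambient_apply, ← hx (Z', b), borderedForm_apply]
      simp only [FormField.inChart_apply, CovecField.inChart_apply, hZ', ← hW]
    rw [Prod.mk_eq_zero] at h0
    exact Prod.ext (chartSymmDeriv_injective hy (hW.symm.trans (h0.1.trans (map_zero _).symm))) h0.2
  have key : (D.n.inChart p) =ᶠ[𝓝 (extChartAt 𝓘(ℝ, E) p p)]
      fun y ↦ ((A y).inverse (ContinuousLinearMap.snd ℝ E ℝ)).1 := by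
    filter_upwards [extChartAt_target_mem_nhds (I := 𝓘(ℝ, E)) p] with y hy
    rw [inverse_apply_eq_of_isInvertible (hAi y hy) (x := (D.n.inChart p y, 0))]
    ext x
    · have h1 := hD.gam_inChart_n hy
      simp [hA, borderedForm_apply, h1]
    · have h2 : D.ell.inChart p y (D.n.inChart p y) = 1 := by
        rw [CovecField.inChart_apply, VecField.chartSymmDeriv_inChart hy, hD.ell_n]
      simp [hA, borderedForm_apply, h2]
  refine DifferentiableAt.congr_of_eventuallyEq ?_ key
  exact (differentiableAt_inverse_apply (hAi _ (mem_extChartAt_target p)) hAd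
    (differentiableAt_const _)).fst

end Tuple

end Data

theorem flatExtDeriv_congr {E : Type*} [NormedAddCommGroup E] [NormedSpace ℝ E]
    {α β : E → E →L[ℝ] ℝ} {y : E} (h : α =ᶠ[𝓝 y] β) : flatExtDeriv α y = flatExtDeriv β y := by
  simp only [flatExtDeriv, h.fderiv_eq]

/-! ### Gauge behaviour of `U`, `s` and `r` -/

section Data

variable {E : Type*} [NormedAddCommGroup E] [NormedSpace ℝ E]
variable {N : Type*} [TopologicalSpace N] [ChartedSpace E N]

/-- The value of a vector field at a point, as an element of the model space. -/
def VecField.toModel (X : VecField E N) (p : N) : E := X p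

/-- The value of a covector field at a point, as a covector on the model space. -/
def CovecField.toModel (α : CovecField E N) (p : N) : E →L[ℝ] ℝ := α p

/-- The value of a 2-covariant tensor field at a point, as a form on the model space. -/
def FormField.toModel (T : FormField E N) (p : N) : E →L[ℝ] E →L[ℝ] ℝ := T p

theorem FormField.Symmetric.inChart {T : FormField E N} (hT : T.Symmetric) (p : N) (y v w : E) :
    T.inChart p y v w = T.inChart p y w v := by
  rw [FormField.inChart_apply, FormField.inChart_apply]
  exact hT _ _ _

section

variable [IsManifold 𝓘(ℝ, E) ∞ N]

theorem VecField.inChart_center (p : N) (X : VecField E N) :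
    X.inChart p (extChartAt 𝓘(ℝ, E) p p) = X.toModel p := X.inChart_self p

theorem CovecField.inChart_center (p : N) (α : CovecField E N) :
    α.inChart p (extChartAt 𝓘(ℝ, E) p p) = α.toModel p := α.inChart_self p

theorem FormField.inChart_center (p : N) (T : FormField E N) :
    T.inChart p (extChartAt 𝓘(ℝ, E) p p) = T.toModel p := T.inChart_self p

theorem lieDeriv_toModel (X : VecField E N) (T : FormField E N) (p : N) :
    (lieDeriv X T).toModel p
      = flatLieDeriv (X.inChart p) (T.inChart p) (extChartAt 𝓘(ℝ, E) p p) :=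
  lieDeriv_eq X T p

theorem extDeriv_toModel (α : CovecField E N) (p : N) :
    (extDeriv α).toModel p = flatExtDeriv (α.inChart p) (extChartAt 𝓘(ℝ, E) p p) :=
  extDeriv_eq α p

theorem lieDeriv_symm {T : FormField E N} (hT : T.Symmetric) (X : VecField E N) :
    (lieDeriv X T).Symmetric := by
  intro p v w
  have h := flatLieDeriv_symm (hT.inChart p) (X.inChart p) (extChartAt 𝓘(ℝ, E) p p)
  rw [← lieDeriv_toModel] at h
  exact h v w

end

theorem differential_toModel {f : N → ℝ} {p : N}
    (hf : ContMDiffAt 𝓘(ℝ, E) 𝓘(ℝ, ℝ) ∞ f p) :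
    (differential (E := E) f).toModel p
      = fderiv ℝ (fun y ↦ f ((extChartAt 𝓘(ℝ, E) p).symm y)) (extChartAt 𝓘(ℝ, E) p p) :=
  differential_eq (hf.mdifferentiableAt (by simp))

namespace Tuple

variable {D : Tuple E N} [IsManifold 𝓘(ℝ, E) ∞ N]

theorem U_toModel (h : ∀ p, D.n2 p = 0) (p : N) :
    D.U.toModel p = (1 / 2 : ℝ) • flatLieDeriv (D.n.inChart p) (D.gam.inChart p)
      (extChartAt 𝓘(ℝ, E) p p) := by
  rw [← lieDeriv_toModel]
  exact U_eq_of_null h p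

theorem IsNullHypersurfaceData.U_symm (hD : D.IsNullHypersurfaceData) : D.U.Symmetric := by
  intro p v w
  rw [U_eq_of_null hD.null]
  exact congrArg (fun t : ℝ ↦ (1 / 2 : ℝ) * t) (lieDeriv_symm hD.gam_symm D.n p v w)

theorem s_toModel (p : N) (w : E) :
    D.s.toModel p w = 1 / 2 * flatExtDeriv (D.ell.inChart p) (extChartAt 𝓘(ℝ, E) p p)
      (D.n.toModel p) w := by
  rw [← extDeriv_toModel]
  rfl

variable [FiniteDimensional ℝ E]

theorem IsNullHypersurfaceData.gam_toModel_n (hD : D.IsNullHypersurfaceData) (p : N) :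
    D.gam.toModel p (D.n.toModel p) = 0 := hD.gam_n p

theorem IsNullHypersurfaceData.fderiv_gam_n (hD : D.IsNullHypersurfaceData) (p : N) (u w : E) :
    D.gam.toModel p (fderiv ℝ (D.n.inChart p) (extChartAt 𝓘(ℝ, E) p p) u) w
      = - fderiv ℝ (D.gam.inChart p) (extChartAt 𝓘(ℝ, E) p p) u (D.n.toModel p) w := by
  have := fderiv_radical (hD.gam_smooth.differentiableAt_inChart p)
    (hD.differentiableAt_inChart_n p) (hD.eventually_gam_inChart_n p) u w
  rwa [FormField.inChart_center, VecField.inChart_center] at this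

/-- Intrinsically, `(£ₙγ)(n, ·) = £ₙ(γ(n, ·)) = 0` because `[n, n] = 0`. In the chart, the first two
terms of `£ₙγ` cancel by the differentiated radical identity and the third contains `γ(n, ·)`. -/
theorem IsNullHypersurfaceData.U_toModel_n (hD : D.IsNullHypersurfaceData) (p : N) (w : E) :
    D.U.toModel p (D.n.toModel p) w = 0 := by
  rw [U_toModel hD.null, smul_apply, smul_apply, flatLieDeriv_apply, FormField.inChart_center,
    VecField.inChart_center, hD.fderiv_gam_n, hD.gam_toModel_n]
  simp

variable {z : N → ℝ} {V : VecField E N}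

theorem IsNullHypersurfaceData.gauge_U (hD : D.IsNullHypersurfaceData)
    (hz : ContMDiff 𝓘(ℝ, E) 𝓘(ℝ, ℝ) ∞ z) (hz0 : ∀ p, z p ≠ 0) (V : VecField E N) (p : N) :
    (D.gauge z V).U.toModel p = (z p)⁻¹ • D.U.toModel p := by
  have hn2 : ∀ p, (D.gauge z V).n2 p = 0 := fun p ↦
    congrArg Prod.snd (hD.gauge_normalPair hz0 V p)
  have hzd : DifferentiableAt ℝ (fun y ↦ (z ((extChartAt 𝓘(ℝ, E) p).symm y))⁻¹)
      (extChartAt 𝓘(ℝ, E) p p) :=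
    (differentiableAt_comp_chart_symm (hz p)).inv (hz0 _)
  have hg : (D.gauge z V).gam = D.gam := rfl
  ext v w
  rw [U_toModel hn2, U_toModel hD.null, hD.gauge_n hz0, hg, VecField.inChart_smul]
  simp only [smul_apply, smul_eq_mul]
  rw [flatLieDeriv_smul _ hzd (hD.differentiableAt_inChart_n p), hD.gam_symm.inChart p _ v,
    hD.gam_inChart_n (mem_extChartAt_target p), extChartAt_to_inv]
  simp only [zero_apply]
  ring

theorem IsNullHypersurfaceData.gauge_s (hD : D.IsNullHypersurfaceData)
    (hz : ContMDiff 𝓘(ℝ, E) 𝓘(ℝ, ℝ) ∞ z) (hz0 : ∀ p, z p ≠ 0) (hV : V.Smooth) (p : N) (w : E) :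
    (D.gauge z V).s.toModel p w = D.s.toModel p w + 1 / 2 * (z p)⁻¹ *
        ((differential z).toModel p (D.n.toModel p)
            * (D.ell.toModel p w + D.gam.toModel p (V.toModel p) w)
          - (differential z).toModel p w)
      + 1 / 2 * (fderiv ℝ (D.gam.inChart p) (extChartAt 𝓘(ℝ, E) p p) (D.n.toModel p)
            (V.toModel p) w
          + D.gam.toModel p (fderiv ℝ (V.inChart p) (extChartAt 𝓘(ℝ, E) p p) (D.n.toModel p)) w
          - fderiv ℝ (D.gam.inChart p) (extChartAt 𝓘(ℝ, E) p p) w (V.toModel p)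
            (D.n.toModel p)) := by
  have := FiniteDimensional.complete ℝ E
  have hz' := hz0 p
  have hell : (D.gauge z V).ell.inChart p =ᶠ[𝓝 (extChartAt 𝓘(ℝ, E) p p)] fun y ↦
      z ((extChartAt 𝓘(ℝ, E) p).symm y) •
        (D.ell.inChart p y + D.gam.inChart p y (V.inChart p y)) := by
    filter_upwards [extChartAt_target_mem_nhds (I := 𝓘(ℝ, E)) p] with y hy
    exact CovecField.inChart_gauge p hy z D.ell D.gam V
  have hn : (D.gauge z V).n.toModel p = (z p)⁻¹ • D.n.toModel p := by
    rw [hD.gauge_n hz0]; rfl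
  have hgn : ∀ u, D.gam.toModel p u (D.n.toModel p) = 0 := fun u ↦
    (hD.gam_symm p _ _).trans (congrArg (fun L : E →L[ℝ] ℝ ↦ L u) (hD.gam_n p))
  have hln : D.ell.toModel p (D.n.toModel p) = 1 := hD.ell_n p
  rw [s_toModel, s_toModel, flatExtDeriv_congr hell, hn, map_smul, smul_apply,
    flatExtDeriv_gauge (hD.gam_smooth.differentiableAt_inChart p)
      (hD.ell_smooth.differentiableAt_inChart p) (differentiableAt_comp_chart_symm (hz p))
      (hV.differentiableAt_inChart p), extChartAt_to_inv, FormField.inChart_center,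
    VecField.inChart_center, CovecField.inChart_center, ← differential_toModel (hz p)]
  simp only [hgn, hln, smul_eq_mul]
  field_simp
  ring

theorem IsNullHypersurfaceData.gauge_r (hD : D.IsNullHypersurfaceData)
    (hz : ContMDiff 𝓘(ℝ, E) 𝓘(ℝ, ℝ) ∞ z) (hz0 : ∀ p, z p ≠ 0) (hV : V.Smooth) (p : N) (w : E) :
    (D.gauge z V).r.toModel p w = D.r.toModel p w + 1 / 2 * (z p)⁻¹ *
        ((differential z).toModel p w + (differential z).toModel p (D.n.toModel p)
            * (D.ell.toModel p w + D.gam.toModel p (V.toModel p) w))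
      + 1 / 2 * flatLieDeriv (V.inChart p) (D.gam.inChart p) (extChartAt 𝓘(ℝ, E) p p)
          (D.n.toModel p) w := by
  have := FiniteDimensional.complete ℝ E
  have hz' := hz0 p
  have hgn := hD.gam_toModel_n p
  have hln : D.ell.toModel p (D.n.toModel p) = 1 := hD.ell_n p
  have hn : (D.gauge z V).n.toModel p = (z p)⁻¹ • D.n.toModel p := by
    rw [hD.gauge_n hz0]; rfl
  have hY : (D.gauge z V).Y.toModel p = z p • D.Y.toModel p
      + symProd (D.ell.toModel p) ((differential z).toModel p)
      + (1 / 2 : ℝ) • (lieDeriv (fun q ↦ z q • V q) D.gam).toModel p := rfl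
  have hr : (D.gauge z V).r.toModel p = (D.gauge z V).Y.toModel p ((D.gauge z V).n.toModel p) := rfl
  have hr0 : D.r.toModel p = D.Y.toModel p (D.n.toModel p) := rfl
  rw [hr, hr0, hn, hY, lieDeriv_toModel, VecField.inChart_smul]
  simp only [map_smul, smul_apply, add_apply, symProd_apply, smul_eq_mul]
  rw [flatLieDeriv_smul _ (differentiableAt_comp_chart_symm (hz p)) (hV.differentiableAt_inChart p),
    extChartAt_to_inv, FormField.inChart_center,
    VecField.inChart_center, ← differential_toModel (hz p), hgn, hln]
  simp only [zero_apply]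
  field_simp
  ring

/-- In the difference the terms with `n(z)` and those with `γ(∂ₙV, ·)` cancel, while the two halves
of `-z⁻¹ dz` add up. What remains is `½ (∂ₙγ(V, w) - ∂_Vγ(n, w) - ∂_wγ(n, V))`, which is `U(V, w)`
once `γ(∂n, ·)` is traded for `-∂γ(n, ·)`. -/
theorem IsNullHypersurfaceData.gauge_s_sub_r (hD : D.IsNullHypersurfaceData)
    (hz : ContMDiff 𝓘(ℝ, E) 𝓘(ℝ, ℝ) ∞ z) (hz0 : ∀ p, z p ≠ 0) (hV : V.Smooth) (p : N) (w : E) :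
    (D.gauge z V).s.toModel p w - (D.gauge z V).r.toModel p w
      = D.s.toModel p w - D.r.toModel p w - (z p)⁻¹ * (differential z).toModel p w
        + D.U.toModel p (V.toModel p) w := by
  rw [hD.gauge_s hz hz0 hV, hD.gauge_r hz hz0 hV, U_toModel hD.null, smul_apply, smul_apply,
    flatLieDeriv_apply, flatLieDeriv_apply, FormField.inChart_center, VecField.inChart_center,
    VecField.inChart_center, hD.gam_toModel_n, hD.fderiv_gam_n,
    show D.gam.toModel p (V.toModel p) (fderiv ℝ (D.n.inChart p) (extChartAt 𝓘(ℝ, E) p p) w)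
      = D.gam.toModel p (fderiv ℝ (D.n.inChart p) (extChartAt 𝓘(ℝ, E) p p) w) (V.toModel p) from
      hD.gam_symm p _ _, hD.fderiv_gam_n,
    fderiv_symm_form (hD.gam_symm.inChart p) _ w (V.toModel p) (D.n.toModel p)]
  simp only [smul_eq_mul, zero_apply]
  ring

end Tuple

end Data

/-! ### Pull-backs in charts and Lie derivatives along related fields -/

section Maps

variable {E : Type*} [NormedAddCommGroup E] [NormedSpace ℝ E]
variable {N : Type*} [TopologicalSpace N] [ChartedSpace E N]
variable {F : Type*} [NormedAddCommGroup F] [NormedSpace ℝ F]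
variable {S : Type*} [TopologicalSpace S] [ChartedSpace F S]

/-- In adapted charts an immersion is `x ↦ (x, 0)` up to a linear equivalence. Projecting to the
first factor gives a local left inverse, differentiable at `f q`, and the chain rule makes the
derivative of `f` left-invertible. -/
theorem mfderiv_injective_of_isImmersionAt [IsManifold 𝓘(ℝ, E) ∞ N] [IsManifold 𝓘(ℝ, F) ∞ S]
    {f : S → N} {q : S} (h : Manifold.IsImmersionAt 𝓘(ℝ, F) 𝓘(ℝ, E) ∞ f q) :
    Function.Injective (mfderiv 𝓘(ℝ, F) 𝓘(ℝ, E) f q) := by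
  obtain ⟨K, _, _, hK⟩ := h
  have hf : MDifferentiableAt 𝓘(ℝ, F) 𝓘(ℝ, E) f q := hK.contMDiffAt.mdifferentiableAt (by simp)
  have hq := hK.mem_domChart_source
  have hfq := hK.mem_codChart_source
  let φ := hK.codChart.extend 𝓘(ℝ, E)
  let χ := hK.domChart.extend 𝓘(ℝ, F)
  let π : E → F := fun e ↦ (hK.equiv.symm e).1
  have hwr : ∀ x ∈ hK.domChart.source, π (φ (f x)) = χ x := fun x hx ↦ by
    have hx' : x ∈ χ.source := by simpa [χ] using hx
    have := hK.writtenInCharts (χ.map_source hx')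
    simp only [Function.comp_apply] at this
    rw [show (hK.domChart.extend 𝓘(ℝ, F)).symm (χ x) = x from χ.left_inv hx'] at this
    simp only [π, φ, this, ContinuousLinearEquiv.symm_apply_apply]
  have hid : (fun x ↦ χ.symm (π (φ (f x)))) =ᶠ[𝓝 q] id := by
    filter_upwards [hK.domChart.open_source.mem_nhds hq] with x hx
    rw [hwr x hx]
    exact χ.left_inv (by simpa [χ] using hx)
  have d1 : MDifferentiableAt 𝓘(ℝ, E) 𝓘(ℝ, E) φ (f q) :=
    (OpenPartialHomeomorph.contMDiffAt_extend hK.codChart_mem_maximalAtlas hfq).mdifferentiableAt (by simp)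
  have d2 : MDifferentiableAt 𝓘(ℝ, E) 𝓘(ℝ, F) π (φ (f q)) :=
    (hK.equiv.symm.differentiableAt.fst).mdifferentiableAt
  have d3 : MDifferentiableAt 𝓘(ℝ, F) 𝓘(ℝ, F) χ.symm (π (φ (f q))) := by
    have h1 := contMDiffOn_extend_symm (n := ∞) (I := 𝓘(ℝ, F)) hK.domChart_mem_maximalAtlas
    rw [hwr q hq]
    refine (h1.contMDiffAt ?_).mdifferentiableAt (by simp)
    have ho : IsOpen (𝓘(ℝ, F) '' hK.domChart.target) := by
      simpa using hK.domChart.open_target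
    exact ho.mem_nhds ⟨_, hK.domChart.map_source hq, rfl⟩
  have d12 : MDifferentiableAt 𝓘(ℝ, E) 𝓘(ℝ, F) (fun x ↦ χ.symm (π (φ x))) (f q) :=
    MDifferentiableAt.comp (f q) (g := χ.symm) (f := fun x ↦ π (φ x)) d3
      (MDifferentiableAt.comp (f q) (g := π) (f := φ) d2 d1)
  have hc := mfderiv_comp q d12 hf
  have hc' : mfderiv 𝓘(ℝ, F) 𝓘(ℝ, F) ((fun x ↦ χ.symm (π (φ x))) ∘ f) q
      = ContinuousLinearMap.id ℝ _ := by
    rw [show (fun x ↦ χ.symm (π (φ x))) ∘ f = fun x ↦ χ.symm (π (φ (f x))) from rfl,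
      hid.mfderiv_eq, mfderiv_id]
  intro a b hab
  have key : ∀ v, mfderiv 𝓘(ℝ, F) 𝓘(ℝ, F) ((fun x ↦ χ.symm (π (φ x))) ∘ f) q v = v := fun v ↦ by
    rw [hc']; rfl
  rw [← key a, ← key b, hc]
  exact congrArg (mfderiv 𝓘(ℝ, E) 𝓘(ℝ, F) (fun x ↦ χ.symm (π (φ x))) (f q)) hab

/-- The derivative of a map at a point, as a map between the model spaces. -/
def derivModel (f : S → N) (q : S) : F →L[ℝ] E := mfderiv 𝓘(ℝ, F) 𝓘(ℝ, E) f q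

/-- The expression of a map in the preferred charts at `q` and `f q`. -/
def mapInChart (f : S → N) (q : S) (y : F) : E :=
  extChartAt 𝓘(ℝ, E) (f q) (f ((extChartAt 𝓘(ℝ, F) q).symm y))

theorem mapInChart_self (f : S → N) (q : S) :
    mapInChart f q (extChartAt 𝓘(ℝ, F) q q) = extChartAt 𝓘(ℝ, E) (f q) (f q) := by
  rw [mapInChart, extChartAt_to_inv]

theorem contDiffAt_mapInChart {f : S → N} {q : S}
    (hf : ContMDiffAt 𝓘(ℝ, F) 𝓘(ℝ, E) ∞ f q) :
    ContDiffAt ℝ ∞ (mapInChart (E := E) f q) (extChartAt 𝓘(ℝ, F) q q) := by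
  have h := (contMDiffAt_iff.1 hf).2
  simp only [ModelWithCorners.range_eq_univ, contDiffWithinAt_univ] at h
  exact h

theorem fderiv_mapInChart_self {f : S → N} {q : S}
    (hf : ContMDiffAt 𝓘(ℝ, F) 𝓘(ℝ, E) ∞ f q) :
    fderiv ℝ (mapInChart (E := E) f q) (extChartAt 𝓘(ℝ, F) q q) = derivModel f q := by
  have h := (hf.mdifferentiableAt (by simp)).mfderiv
  rw [ModelWithCorners.range_eq_univ, fderivWithin_univ] at h
  exact h.symm

theorem differentiableAt_fderiv_mapInChart {f : S → N} {q : S}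
    (hf : ContMDiffAt 𝓘(ℝ, F) 𝓘(ℝ, E) ∞ f q) : DifferentiableAt ℝ (fderiv ℝ (mapInChart (E := E) f q)) (extChartAt 𝓘(ℝ, F) q q) :=
  ((contDiffAt_mapInChart hf).fderiv_right (m := 1) (by norm_cast)).differentiableAt
    (by norm_num)

/-- The points of the preferred chart at `q` at which `f` takes values in the preferred chart
at `f q`. -/
theorem eventually_mapInChart {f : S → N} (hf : ContMDiff 𝓘(ℝ, F) 𝓘(ℝ, E) ∞ f) (q : S) :
    ∀ᶠ y in 𝓝 (extChartAt 𝓘(ℝ, F) q q), y ∈ (extChartAt 𝓘(ℝ, F) q).target ∧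
      f ((extChartAt 𝓘(ℝ, F) q).symm y) ∈ (extChartAt 𝓘(ℝ, E) (f q)).source := by
  refine Filter.Eventually.and (extChartAt_target_mem_nhds (I := 𝓘(ℝ, F)) q) ?_
  have hc : ContinuousAt (fun y ↦ f ((extChartAt 𝓘(ℝ, F) q).symm y)) (extChartAt 𝓘(ℝ, F) q q) :=
    hf.continuous.continuousAt.comp (continuousAt_extChartAt_symm q)
  refine hc.eventually_mem ?_
  rw [extChartAt_to_inv]
  exact extChartAt_source_mem_nhds (f q)

variable [IsManifold 𝓘(ℝ, E) ∞ N] [IsManifold 𝓘(ℝ, F) ∞ S]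

/-- The chain rule for the two factorizations of `f` through the charts. It is needed on a
neighbourhood, not only at the centre, because chart expressions of pull-backs get differentiated.
-/
theorem eventually_fderiv_mapInChart {f : S → N} (hf : ContMDiff 𝓘(ℝ, F) 𝓘(ℝ, E) ∞ f) (q : S) :
    ∀ᶠ y in 𝓝 (extChartAt 𝓘(ℝ, F) q q), y ∈ (extChartAt 𝓘(ℝ, F) q).target ∧
      mapInChart f q y ∈ (extChartAt 𝓘(ℝ, E) (f q)).target ∧
      (extChartAt 𝓘(ℝ, E) (f q)).symm (mapInChart f q y) = f ((extChartAt 𝓘(ℝ, F) q).symm y) ∧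
      ∀ v : F, chartSymmDeriv (f q) (mapInChart f q y) (fderiv ℝ (mapInChart f q) y v)
        = derivModel (E := E) f ((extChartAt 𝓘(ℝ, F) q).symm y) (chartSymmDeriv q y v) := by
  filter_upwards [(eventually_mapInChart hf q).eventually_nhds,
    ((contDiffAt_mapInChart (hf q)).of_le (m := 1) (by norm_cast)).eventually (by simp)]
    with y hy hd
  obtain ⟨hy1, hy2⟩ := hy.self_of_nhds
  have ht : mapInChart f q y ∈ (extChartAt 𝓘(ℝ, E) (f q)).target :=
    (extChartAt 𝓘(ℝ, E) (f q)).map_source hy2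
  refine ⟨hy1, ht, (extChartAt 𝓘(ℝ, E) (f q)).left_inv hy2, fun v ↦ ?_⟩
  have heq : (extChartAt 𝓘(ℝ, E) (f q)).symm ∘ mapInChart f q
      =ᶠ[𝓝 y] f ∘ (extChartAt 𝓘(ℝ, F) q).symm := by
    filter_upwards [hy] with x hx
    exact (extChartAt 𝓘(ℝ, E) (f q)).left_inv hx.2
  have d1 : MDifferentiableAt 𝓘(ℝ, E) 𝓘(ℝ, E) (extChartAt 𝓘(ℝ, E) (f q)).symm
      (mapInChart f q y) := by
    refine ((contMDiffOn_extChartAt_symm (n := ∞) (f q)).contMDiffAt ?_).mdifferentiableAt (by simp)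
    exact (isOpen_extChartAt_target (f q)).mem_nhds ht
  have d2 : MDifferentiableAt 𝓘(ℝ, F) 𝓘(ℝ, F) (extChartAt 𝓘(ℝ, F) q).symm y := by
    refine ((contMDiffOn_extChartAt_symm (n := ∞) q).contMDiffAt ?_).mdifferentiableAt (by simp)
    exact (isOpen_extChartAt_target q).mem_nhds hy1
  have d3 : MDifferentiableAt 𝓘(ℝ, F) 𝓘(ℝ, E) (mapInChart f q) y :=
    (hd.differentiableAt (by simp)).mdifferentiableAt
  have h1 := mfderiv_comp y d1 d3
  have h2 := mfderiv_comp y ((hf _).mdifferentiableAt (by simp)) d2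
  rw [heq.mfderiv_eq, h2, mfderiv_eq_fderiv] at h1
  exact (congrArg (fun L : F →L[ℝ] E ↦ L v) h1).symm

theorem FormField.eventually_inChart_pullback {f : S → N}
    (hf : ContMDiff 𝓘(ℝ, F) 𝓘(ℝ, E) ∞ f) (q : S) (T : FormField E N) :
    (FormField.pullback (F := F) f T).inChart q =ᶠ[𝓝 (extChartAt 𝓘(ℝ, F) q q)]
      fun y ↦ bilinComp (T.inChart (f q) (mapInChart f q y)) (fderiv ℝ (mapInChart f q) y)
        (fderiv ℝ (mapInChart f q) y) := by
  filter_upwards [eventually_fderiv_mapInChart hf q] with y ⟨_, _, h3, h4⟩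
  ext v w
  have e : T.inChart (f q) (mapInChart f q y) (fderiv ℝ (mapInChart f q) y v)
        (fderiv ℝ (mapInChart f q) y w)
      = T.toModel ((extChartAt 𝓘(ℝ, E) (f q)).symm (mapInChart f q y))
        (chartSymmDeriv (f q) (mapInChart f q y) (fderiv ℝ (mapInChart f q) y v))
        (chartSymmDeriv (f q) (mapInChart f q y) (fderiv ℝ (mapInChart f q) y w)) := rfl
  rw [bilinComp_apply, e, h3, h4, h4]
  rfl

theorem CovecField.eventually_inChart_pullback {f : S → N}
    (hf : ContMDiff 𝓘(ℝ, F) 𝓘(ℝ, E) ∞ f) (q : S) (α : CovecField E N) :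
    (CovecField.pullback (F := F) f α).inChart q =ᶠ[𝓝 (extChartAt 𝓘(ℝ, F) q q)]
      fun y ↦ (α.inChart (f q) (mapInChart f q y)) ∘L (fderiv ℝ (mapInChart f q) y) := by
  filter_upwards [eventually_fderiv_mapInChart hf q] with y ⟨_, _, h3, h4⟩
  ext v
  have e : α.inChart (f q) (mapInChart f q y) (fderiv ℝ (mapInChart f q) y v)
      = α.toModel ((extChartAt 𝓘(ℝ, E) (f q)).symm (mapInChart f q y))
        (chartSymmDeriv (f q) (mapInChart f q y) (fderiv ℝ (mapInChart f q) y v)) := rfl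
  rw [ContinuousLinearMap.comp_apply, e, h3, h4]
  rfl

theorem FormField.differentiableAt_inChart_pullback {f : S → N}
    (hf : ContMDiff 𝓘(ℝ, F) 𝓘(ℝ, E) ∞ f) (q : S) {T : FormField E N}
    (hT : DifferentiableAt ℝ (T.inChart (f q)) (extChartAt 𝓘(ℝ, E) (f q) (f q))) :
    DifferentiableAt ℝ ((FormField.pullback (F := F) f T).inChart q)
      (extChartAt 𝓘(ℝ, F) q q) := by
  refine DifferentiableAt.congr_of_eventuallyEq ?_ (eventually_inChart_pullback hf q T)
  rw [← mapInChart_self (F := F) f q] at hT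
  exact differentiableAt_bilinComp
    (DifferentiableAt.comp (G := E →L[ℝ] E →L[ℝ] ℝ) (g := T.inChart (f q)) _ hT
      ((contDiffAt_mapInChart (hf q)).differentiableAt (by simp)))
    (differentiableAt_fderiv_mapInChart (hf q))

theorem CovecField.differentiableAt_inChart_pullback {f : S → N}
    (hf : ContMDiff 𝓘(ℝ, F) 𝓘(ℝ, E) ∞ f) (q : S) {α : CovecField E N}
    (hα : DifferentiableAt ℝ (α.inChart (f q)) (extChartAt 𝓘(ℝ, E) (f q) (f q))) :
    DifferentiableAt ℝ ((CovecField.pullback (F := F) f α).inChart q)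
      (extChartAt 𝓘(ℝ, F) q q) := by
  refine DifferentiableAt.congr_of_eventuallyEq ?_ (eventually_inChart_pullback hf q α)
  rw [← mapInChart_self (F := F) f q] at hα
  exact (DifferentiableAt.comp (G := E →L[ℝ] ℝ) (g := α.inChart (f q)) _ hα
      ((contDiffAt_mapInChart (hf q)).differentiableAt (by simp))).clm_comp
    (differentiableAt_fderiv_mapInChart (hf q))

/-- The Lie derivative along a vector field which is `f`-related to `W` up to a multiple of a
field `n` in the radical of `T`. -/
theorem lieDeriv_pullback {f : S → N} (hf : ContMDiff 𝓘(ℝ, F) 𝓘(ℝ, E) ∞ f) {T : FormField E N}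
    (hTs : T.Symmetric) {X n : VecField E N} {W : VecField F S} {c : S → ℝ} (q : S)
    (hT : DifferentiableAt ℝ (T.inChart (f q)) (extChartAt 𝓘(ℝ, E) (f q) (f q)))
    (hX : DifferentiableAt ℝ (X.inChart (f q)) (extChartAt 𝓘(ℝ, E) (f q) (f q)))
    (hn : DifferentiableAt ℝ (n.inChart (f q)) (extChartAt 𝓘(ℝ, E) (f q) (f q)))
    (hW : DifferentiableAt ℝ (W.inChart q) (extChartAt 𝓘(ℝ, F) q q))
    (hrad : ∀ᶠ x in 𝓝 (extChartAt 𝓘(ℝ, E) (f q) (f q)),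
      T.inChart (f q) x (n.inChart (f q) x) = 0)
    (hrel : ∀ q', X.toModel (f q')
      = derivModel f q' (W.toModel q') + c q' • n.toModel (f q')) (v w : F) :
    (lieDeriv X T).toModel (f q) (derivModel f q v) (derivModel f q w)
      = (lieDeriv W (FormField.pullback f T)).toModel q v w
        + c q * (lieDeriv n T).toModel (f q) (derivModel f q v) (derivModel f q w) := by
  have hrel' : ∀ᶠ y in 𝓝 (extChartAt 𝓘(ℝ, F) q q), X.inChart (f q) (mapInChart f q y)
      = fderiv ℝ (mapInChart f q) y (W.inChart q y)
        + c ((extChartAt 𝓘(ℝ, F) q).symm y) • n.inChart (f q) (mapInChart f q y) := by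
    filter_upwards [eventually_fderiv_mapInChart hf q] with y ⟨h1, h2, h3, h4⟩
    refine chartSymmDeriv_injective h2 ?_
    have e : ∀ Z : VecField E N, chartSymmDeriv (f q) (mapInChart f q y)
        (Z.inChart (f q) (mapInChart f q y)) = Z.toModel (f ((extChartAt 𝓘(ℝ, F) q).symm y)) :=
      fun Z ↦ by rw [← h3]; exact Z.chartSymmDeriv_inChart h2
    have e' : chartSymmDeriv q y (W.inChart q y) = W.toModel ((extChartAt 𝓘(ℝ, F) q).symm y) :=
      W.chartSymmDeriv_inChart h1
    rw [map_add, map_smul, h4, e, e, e', hrel]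
  rw [← mapInChart_self (F := F) f q] at hT hX hn hrad
  have key := flatLieDeriv_pullback (hTs.inChart (f q)) hT hX hn hW
    ((contDiffAt_mapInChart (hf q)).of_le (by norm_cast)) hrad hrel' v w
  rw [fderiv_mapInChart_self (hf q), mapInChart_self, ← lieDeriv_toModel, ← lieDeriv_toModel,
    ← flatLieDeriv_congr Filter.EventuallyEq.rfl (FormField.eventually_inChart_pullback hf q T),
    ← lieDeriv_toModel, extChartAt_to_inv] at key
  exact key

/-- Applied with `B = h` to `ℓ_∥^♯` and to the tangential part of `V`: in the chart the field still
solves the linear equation given by the chart expressions of `B` and `β`. -/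
theorem VecField.inChart_inverse [FiniteDimensional ℝ F] {B : FormField F S} {β : CovecField F S}
    (hB : ∀ q (x : F), (∀ y, B.toModel q x y = 0) → x = 0) (q : S)
    (hBd : DifferentiableAt ℝ (B.inChart q) (extChartAt 𝓘(ℝ, F) q q))
    (hβ : DifferentiableAt ℝ (β.inChart q) (extChartAt 𝓘(ℝ, F) q q)) :
    DifferentiableAt ℝ (VecField.inChart q (fun q ↦ (B q).inverse (β q)))
      (extChartAt 𝓘(ℝ, F) q q) := by
  have := FiniteDimensional.complete ℝ F
  have hBi : ∀ q, (B.toModel q).IsInvertible := fun q ↦ isInvertible_of_nondegenerate _ (hB q)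
  have hBh : ∀ y ∈ (extChartAt 𝓘(ℝ, F) q).target, (B.inChart q y).IsInvertible := by
    refine fun y hy ↦ isInvertible_of_nondegenerate _ fun x hx ↦ ?_
    refine chartSymmDeriv_injective hy ((hB ((extChartAt 𝓘(ℝ, F) q).symm y) _
      fun u ↦ ?_).trans (map_zero _).symm)
    obtain ⟨u', rfl⟩ := chartSymmDeriv_surjective hy u
    exact hx u'
  refine (differentiableAt_inverse_apply (hBh _ (mem_extChartAt_target q)) hBd
    hβ).congr_of_eventuallyEq ?_
  filter_upwards [extChartAt_target_mem_nhds (I := 𝓘(ℝ, F)) q] with y hy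
  refine (inverse_apply_eq_of_isInvertible (hBh y hy) ?_).symm
  ext v
  have e : chartSymmDeriv q y (VecField.inChart q (fun q ↦ (B q).inverse (β q)) y)
      = (B.toModel ((extChartAt 𝓘(ℝ, F) q).symm y)).inverse
        (β.toModel ((extChartAt 𝓘(ℝ, F) q).symm y)) := VecField.chartSymmDeriv_inChart hy _
  have e2 : B.inChart q y (VecField.inChart q (fun q ↦ (B q).inverse (β q)) y) v
      = B.toModel ((extChartAt 𝓘(ℝ, F) q).symm y)
        (chartSymmDeriv q y (VecField.inChart q (fun q ↦ (B q).inverse (β q)) y))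
        (chartSymmDeriv q y v) := rfl
  rw [e2, e, apply_inverse_of_isInvertible (hBi _)]
  rfl

end Maps

/-! ### Lie derivatives along sums and multiples of fields -/

section

variable {M : Type*} {E : Type*} [NormedAddCommGroup E] [NormedSpace ℝ E]
  [TopologicalSpace M] [ChartedSpace E M] [IsManifold 𝓘(ℝ, E) ∞ M]

theorem lieDeriv_add_toModel {X X' : VecField E M} {p : M} (T : FormField E M)
    (hX : DifferentiableAt ℝ (X.inChart p) (extChartAt 𝓘(ℝ, E) p p))
    (hX' : DifferentiableAt ℝ (X'.inChart p) (extChartAt 𝓘(ℝ, E) p p)) :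
    (lieDeriv (fun q ↦ X q + X' q) T).toModel p
      = (lieDeriv X T).toModel p + (lieDeriv X' T).toModel p := by
  rw [lieDeriv_toModel, VecField.inChart_add, flatLieDeriv_add _ hX hX', ← lieDeriv_toModel,
    ← lieDeriv_toModel]

theorem lieDeriv_smul_toModel {f : M → ℝ} {X : VecField E M} {p : M} (T : FormField E M)
    (hf : ContMDiffAt 𝓘(ℝ, E) 𝓘(ℝ, ℝ) ∞ f p)
    (hX : DifferentiableAt ℝ (X.inChart p) (extChartAt 𝓘(ℝ, E) p p)) (v w : E) :
    (lieDeriv (fun q ↦ f q • X q) T).toModel p v w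
      = f p * (lieDeriv X T).toModel p v w
        + (differential f).toModel p v * T.toModel p (X.toModel p) w
        + (differential f).toModel p w * T.toModel p v (X.toModel p) := by
  rw [lieDeriv_toModel, VecField.inChart_smul,
    flatLieDeriv_smul _ (differentiableAt_comp_chart_symm hf) hX, ← lieDeriv_toModel,
    ← differential_toModel hf, FormField.inChart_center, VecField.inChart_center, extChartAt_to_inv]

end

/-! ### Splitting along `S` and the gauge laws -/

namespace Tuple

variable {E : Type*} [NormedAddCommGroup E] [NormedSpace ℝ E]
variable {N : Type*} [TopologicalSpace N] [ChartedSpace E N]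
variable {F : Type*} [NormedAddCommGroup F] [NormedSpace ℝ F]
variable {S : Type*} [TopologicalSpace S] [ChartedSpace F S]
variable {D : Tuple E N} {ψ : S → N}

variable (F) in
/-- The covector `ψ⋆(γ(V, ·))`. -/
def gamPar (D : Tuple E N) (ψ : S → N) (V : VecField E N) : CovecField F S :=
  CovecField.pullback ψ (fun p ↦ D.gam p (V p))

variable (F) in
/-- The vector field on `S` whose image is the component of `V` tangent to `ψ(S)` along `n`. -/
def tangentPart (D : Tuple E N) (ψ : S → N) (V : VecField E N) : VecField F S := fun q ↦
  (D.h F ψ q).inverse (D.gamPar F ψ V q)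

variable (F) in
/-- The component of `V` along `n`. -/
def normalPart (D : Tuple E N) (ψ : S → N) (V : VecField E N) (q : S) : ℝ :=
  D.ell.toModel (ψ q)
    (V.toModel (ψ q) - derivModel ψ q ((D.tangentPart F ψ V).toModel q))

theorem gauge_ellSharp (z : N → ℝ) (V : VecField E N) :
    (D.gauge z V).ellSharp F ψ
      = fun q ↦ z (ψ q) • (D.ellSharp F ψ q + D.tangentPart F ψ V q) := by
  funext q
  have e : (D.gauge z V).ellPar F ψ q = z (ψ q) • (D.ellPar F ψ q + D.gamPar F ψ V q) := rfl
  have eh : (D.gauge z V).h F ψ = D.h F ψ := rfl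
  rw [ellSharp, e, eh, map_smul, map_add]
  rfl

theorem omega_toModel (q : S) (v : F) : (D.omega F ψ).toModel q v
    = D.s.toModel (ψ q) (derivModel ψ q v) - D.r.toModel (ψ q) (derivModel ψ q v)
      - D.U.toModel (ψ q) (derivModel ψ q ((D.ellSharp F ψ).toModel q)) (derivModel ψ q v) := rfl

theorem sec_toModel (q : S) (v w : F) : (D.sec F ψ).toModel q v w
    = D.Y.toModel (ψ q) (derivModel ψ q v) (derivModel ψ q w)
      + (1 / 2 : ℝ) * ((D.ellPar F ψ).toModel q ((D.ellSharp F ψ).toModel q) - D.ell2 (ψ q))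
        * D.U.toModel (ψ q) (derivModel ψ q v) (derivModel ψ q w)
      - (1 / 2 : ℝ) * (lieDeriv (D.ellSharp F ψ) (D.h F ψ)).toModel q v w := rfl

theorem differential_comp {z : N → ℝ} (hz : ContMDiff 𝓘(ℝ, E) 𝓘(ℝ, ℝ) ∞ z)
    (hψ : ContMDiff 𝓘(ℝ, F) 𝓘(ℝ, E) ∞ ψ) (q : S) (v : F) :
    (differential (E := F) (z ∘ ψ)).toModel q v
      = (differential (E := E) z).toModel (ψ q) (derivModel ψ q v) := by
  have h := mfderiv_comp q ((hz (ψ q)).mdifferentiableAt (by simp))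
    ((hψ q).mdifferentiableAt (by simp))
  exact congrArg (fun L : F →L[ℝ] ℝ ↦ L v) h

variable [IsManifold 𝓘(ℝ, E) ∞ N] [IsManifold 𝓘(ℝ, F) ∞ S]

theorem IsTransverse.derivModel_injective (hψ : D.IsTransverse F ψ) (q : S) :
    Function.Injective (derivModel (E := E) (F := F) ψ q) :=
  mfderiv_injective_of_isImmersionAt (hψ.embedding.isImmersion.isImmersionAt q)

theorem IsNullHypersurfaceData.sec_symm (hD : D.IsNullHypersurfaceData) :
    (D.sec F ψ).Symmetric := by
  have key : ∀ (q : S) (v w : F), (D.sec F ψ).toModel q v w = (D.sec F ψ).toModel q w v := by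
    intro q v w
    have h1 : D.Y.toModel (ψ q) (derivModel ψ q v) (derivModel ψ q w)
      = D.Y.toModel (ψ q) (derivModel ψ q w) (derivModel ψ q v) := hD.Y_symm _ _ _
    have h2 : D.U.toModel (ψ q) (derivModel ψ q v) (derivModel ψ q w)
      = D.U.toModel (ψ q) (derivModel ψ q w) (derivModel ψ q v) := hD.U_symm _ _ _
    have h3 : (lieDeriv (D.ellSharp F ψ) (D.h F ψ)).toModel q v w
      = (lieDeriv (D.ellSharp F ψ) (D.h F ψ)).toModel q w v :=
      lieDeriv_symm (T := D.h F ψ) (fun q v w ↦ hD.gam_symm _ _ _) (D.ellSharp F ψ) q v w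
    rw [sec_toModel, sec_toModel, h1, h2, h3]
  exact key

variable [FiniteDimensional ℝ E] [FiniteDimensional ℝ F] {V : VecField E N} {z : N → ℝ}

/-- Transversality makes `(a, t) ↦ dψ(a) + t n` injective, and equality of dimensions makes it
surjective. -/
theorem IsTransverse.exists_decomposition (hψ : D.IsTransverse F ψ)
    (hdim : Module.finrank ℝ E = Module.finrank ℝ F + 1) (q : S) (u : E) :
    ∃ (a : F) (t : ℝ), u = derivModel ψ q a + t • D.n.toModel (ψ q) := by
  let L : F × ℝ →ₗ[ℝ] E := LinearMap.coprod (derivModel (E := E) (F := F) ψ q : F →ₗ[ℝ] E)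
    (LinearMap.toSpanSingleton ℝ E (D.n.toModel (ψ q)))
  have hL : ∀ a t, L (a, t) = derivModel ψ q a + t • D.n.toModel (ψ q) := fun a t ↦ by
    simp [L]
  have hinj : Function.Injective L := by
    rw [← LinearMap.ker_eq_bot, LinearMap.ker_eq_bot']
    rintro ⟨a, t⟩ h
    rw [hL] at h
    have ht : t = 0 := by
      by_contra ht
      -- If `t ≠ 0`, then `dψ(a) + t n = 0` gives `n = dψ(-t⁻¹ a)`, against transversality.
      refine hψ.transverse q ⟨-(t⁻¹ • a : F), ?_⟩
      have : derivModel ψ q (-(t⁻¹ • a)) = D.n.toModel (ψ q) := by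
        rw [map_neg, map_smul, eq_neg_of_add_eq_zero_left h, smul_neg, neg_neg, smul_smul,
          inv_mul_cancel₀ ht, one_smul]
      exact this
    subst ht
    rw [zero_smul, add_zero] at h
    rw [hψ.derivModel_injective q (h.trans (map_zero _).symm)]
    rfl
  have hsurj := (LinearMap.injective_iff_surjective_of_finrank_eq_finrank
    (by rw [hdim, Module.finrank_prod, Module.finrank_self])).1 hinj
  obtain ⟨⟨a, t⟩, h⟩ := hsurj u
  exact ⟨a, t, by rw [← h, hL]⟩

theorem IsNullHypersurfaceData.eq_zero_of_gam_derivModel (hD : D.IsNullHypersurfaceData)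
    (hψ : D.IsTransverse F ψ)
    (hdim : Module.finrank ℝ E = Module.finrank ℝ F + 1) (q : S) {x : E}
    (hx : ∀ a : F, D.gam.toModel (ψ q) x (derivModel ψ q a) = 0) :
    x = D.ell.toModel (ψ q) x • D.n.toModel (ψ q) := by
  refine hD.eq_smul_n (p := ψ q) fun u ↦ ?_
  obtain ⟨a, t, hu⟩ := hψ.exists_decomposition hdim q u
  have hs : D.gam.toModel (ψ q) x (D.n.toModel (ψ q)) = 0 :=
    (hD.gam_symm (ψ q) _ _).trans (congrArg (fun L : E →L[ℝ] ℝ ↦ L x) (hD.gam_toModel_n (ψ q)))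
  have : D.gam.toModel (ψ q) x (derivModel ψ q a + t • D.n.toModel (ψ q)) = 0 := by
    rw [map_add, map_smul, hx, hs, smul_zero, add_zero]
  rw [← hu] at this
  exact this

/-- If `x` is in the radical of `h`, then `dψ(x)` is in the radical of `γ`, hence a multiple of `n`;
transversality forces the multiple to be zero. -/
theorem IsNullHypersurfaceData.h_nondegenerate (hD : D.IsNullHypersurfaceData)
    (hψ : D.IsTransverse F ψ)
    (hdim : Module.finrank ℝ E = Module.finrank ℝ F + 1) (q : S) (x : F)
    (hx : ∀ y, (D.h F ψ).toModel q x y = 0) : x = 0 := by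
  have h1 := hD.eq_zero_of_gam_derivModel hψ hdim q (x := derivModel ψ q x) hx
  have h2 : D.ell.toModel (ψ q) (derivModel ψ q x) = 0 := by
    by_contra ht
    refine hψ.transverse q ⟨(D.ell.toModel (ψ q) (derivModel ψ q x))⁻¹ • x, ?_⟩
    have : derivModel ψ q ((D.ell.toModel (ψ q) (derivModel (E := E) ψ q x))⁻¹ • x)
        = D.n.toModel (ψ q) := by
      rw [map_smul]
      nth_rw 2 [h1]
      rw [smul_smul, inv_mul_cancel₀ ht, one_smul]
    exact this
  rw [h2, zero_smul] at h1
  exact hψ.derivModel_injective q (h1.trans (map_zero _).symm)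

theorem IsNullHypersurfaceData.h_isInvertible (hD : D.IsNullHypersurfaceData)
    (hψ : D.IsTransverse F ψ) (hdim : Module.finrank ℝ E = Module.finrank ℝ F + 1) (q : S) :
    ((D.h F ψ).toModel q).IsInvertible :=
  isInvertible_of_nondegenerate _ (hD.h_nondegenerate hψ hdim q)

theorem IsNullHypersurfaceData.h_ellSharp (hD : D.IsNullHypersurfaceData)
    (hψ : D.IsTransverse F ψ) (hdim : Module.finrank ℝ E = Module.finrank ℝ F + 1) (q : S) :
    (D.h F ψ).toModel q ((D.ellSharp F ψ).toModel q) = (D.ellPar F ψ).toModel q :=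
  apply_inverse_of_isInvertible (hD.h_isInvertible hψ hdim q) _

theorem IsNullHypersurfaceData.h_tangentPart (hD : D.IsNullHypersurfaceData)
    (hψ : D.IsTransverse F ψ) (hdim : Module.finrank ℝ E = Module.finrank ℝ F + 1)
    (V : VecField E N) (q : S) :
    (D.h F ψ).toModel q ((D.tangentPart F ψ V).toModel q) = (D.gamPar F ψ V).toModel q :=
  apply_inverse_of_isInvertible (hD.h_isInvertible hψ hdim q) _

/-- By the choice of the tangential part, `V - dψ(V_∥)` is `γ`-orthogonal to the image of `dψ`; it
is also orthogonal to `n`, so it lies in the radical of `γ`. -/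
theorem IsNullHypersurfaceData.decomposition (hD : D.IsNullHypersurfaceData)
    (hψ : D.IsTransverse F ψ) (hdim : Module.finrank ℝ E = Module.finrank ℝ F + 1)
    (V : VecField E N) (q : S) :
    V.toModel (ψ q) = derivModel ψ q ((D.tangentPart F ψ V).toModel q)
      + D.normalPart F ψ V q • D.n.toModel (ψ q) := by
  rw [← sub_eq_iff_eq_add']
  refine hD.eq_zero_of_gam_derivModel hψ hdim q fun a ↦ ?_
  have h1 := congrArg (fun L ↦ L a) (hD.h_tangentPart hψ hdim V q)
  rw [map_sub, sub_apply, sub_eq_zero]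
  exact h1.symm

theorem IsNullHypersurfaceData.gauge_omega (hD : D.IsNullHypersurfaceData)
    (hψ : D.IsTransverse F ψ) (hdim : Module.finrank ℝ E = Module.finrank ℝ F + 1)
    (hz : ContMDiff 𝓘(ℝ, E) 𝓘(ℝ, ℝ) ∞ z) (hz0 : ∀ p, z p ≠ 0) (hV : V.Smooth) (q : S) (v : F) :
    ((D.gauge z V).omega F ψ).toModel q v = (D.omega F ψ).toModel q v
      - (z (ψ q))⁻¹ * (differential (E := F) (z ∘ ψ)).toModel q v := by
  have e : ((D.gauge z V).ellSharp F ψ).toModel q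
      = z (ψ q) • ((D.ellSharp F ψ).toModel q + (D.tangentPart F ψ V).toModel q) := by
    rw [gauge_ellSharp]; rfl
  rw [omega_toModel, omega_toModel, hD.gauge_s_sub_r hz hz0 hV, hD.gauge_U hz hz0,
    differential_comp (F := F) hz hψ.embedding.contMDiff, hD.decomposition hψ hdim V q, e]
  simp only [map_smul, map_add, smul_apply, add_apply, smul_eq_mul, hD.U_toModel_n]
  have := hz0 (ψ q)
  field_simp
  ring

theorem IsNullHypersurfaceData.gauge_sec (hD : D.IsNullHypersurfaceData)
    (hψ : D.IsTransverse F ψ) (hdim : Module.finrank ℝ E = Module.finrank ℝ F + 1)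
    (hz : ContMDiff 𝓘(ℝ, E) 𝓘(ℝ, ℝ) ∞ z) (hz0 : ∀ p, z p ≠ 0) (hV : V.Smooth) (q : S) (v w : F) :
    ((D.gauge z V).sec F ψ).toModel q v w = z (ψ q) * (D.sec F ψ).toModel q v w := by
  have := FiniteDimensional.complete ℝ E
  have hψs := hψ.embedding.contMDiff
  have hγ := hD.gam_smooth.differentiableAt_inChart (ψ q)
  have hzψ : ContMDiff 𝓘(ℝ, F) 𝓘(ℝ, ℝ) ∞ (z ∘ ψ) := hz.comp hψs
  have hzE := differentiableAt_comp_chart_symm (hz (ψ q))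
  have hzF := differentiableAt_comp_chart_symm (hzψ q)
  have hh : DifferentiableAt ℝ ((D.h F ψ).inChart q) (extChartAt 𝓘(ℝ, F) q q) :=
    FormField.differentiableAt_inChart_pullback hψs q hγ
  have hVd := hV.differentiableAt_inChart (ψ q)
  have hgamV : DifferentiableAt ℝ (CovecField.inChart (ψ q) (fun p ↦ D.gam p (V p)))
      (extChartAt 𝓘(ℝ, E) (ψ q) (ψ q)) := by
    refine (hγ.clm_apply hVd).congr_of_eventuallyEq ?_
    filter_upwards [extChartAt_target_mem_nhds (I := 𝓘(ℝ, E)) (ψ q)] with y hy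
    ext u
    rw [FormField.inChart_apply, V.chartSymmDeriv_inChart hy]
    rfl
  have hellS : DifferentiableAt ℝ ((D.ellSharp F ψ).inChart q) (extChartAt 𝓘(ℝ, F) q q) :=
    VecField.inChart_inverse (B := D.h F ψ) (hD.h_nondegenerate hψ hdim) q hh
      (CovecField.differentiableAt_inChart_pullback hψs q
        (hD.ell_smooth.differentiableAt_inChart (ψ q)))
  have htan : DifferentiableAt ℝ ((D.tangentPart F ψ V).inChart q) (extChartAt 𝓘(ℝ, F) q q) :=
    VecField.inChart_inverse (B := D.h F ψ) (hD.h_nondegenerate hψ hdim) q hh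
      (CovecField.differentiableAt_inChart_pullback hψs q hgamV)
  -- the Lie derivative along the tangent part of the gauge field
  have hrel : ∀ q', VecField.toModel (fun p ↦ z p • V p) (ψ q')
      = derivModel ψ q' (VecField.toModel (fun x ↦ z (ψ x) • D.tangentPart F ψ V x) q')
        + (z (ψ q') * D.normalPart F ψ V q') • D.n.toModel (ψ q') := fun q' ↦ by
    have e1 : VecField.toModel (fun p ↦ z p • V p) (ψ q') = z (ψ q') • V.toModel (ψ q') := rfl
    have e2 : VecField.toModel (fun x ↦ z (ψ x) • D.tangentPart F ψ V x) q'
      = z (ψ q') • (D.tangentPart F ψ V).toModel q' := rfl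
    rw [e1, e2, hD.decomposition hψ hdim V q', smul_add, map_smul, smul_smul]
  have hX : DifferentiableAt ℝ (VecField.inChart (ψ q) (fun p ↦ z p • V p))
      (extChartAt 𝓘(ℝ, E) (ψ q) (ψ q)) := by
    rw [VecField.inChart_smul]
    exact hzE.smul hVd
  have hW : DifferentiableAt ℝ (VecField.inChart q (fun x ↦ z (ψ x) • D.tangentPart F ψ V x))
      (extChartAt 𝓘(ℝ, F) q q) := by
    rw [VecField.inChart_smul q (fun x ↦ z (ψ x))]
    exact hzF.smul htan
  -- Here `c = ẑ μ`, with `μ` the component of `V` along `n`.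
  have hL := lieDeriv_pullback hψs hD.gam_symm q hγ hX (hD.differentiableAt_inChart_n (ψ q)) hW
    (hD.eventually_gam_inChart_n (ψ q)) hrel v w
  have hU : D.U.toModel (ψ q) = (1 / 2 : ℝ) • (lieDeriv D.n D.gam).toModel (ψ q) :=
    U_eq_of_null hD.null (ψ q)
  have hS : (lieDeriv ((D.gauge z V).ellSharp F ψ) (D.h F ψ)).toModel q v w
      = z (ψ q) * (lieDeriv (D.ellSharp F ψ) (D.h F ψ)).toModel q v w
        + (differential (E := F) (z ∘ ψ)).toModel q v * (D.ellPar F ψ).toModel q w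
        + (differential (E := F) (z ∘ ψ)).toModel q w * (D.ellPar F ψ).toModel q v
        + (lieDeriv (fun x ↦ z (ψ x) • D.tangentPart F ψ V x) (D.h F ψ)).toModel q v w := by
    have e : (D.gauge z V).ellSharp F ψ = fun x ↦ (z ∘ ψ) x • D.ellSharp F ψ x
        + z (ψ x) • D.tangentPart F ψ V x := by
      rw [gauge_ellSharp]; funext x; rw [smul_add]; rfl
    have hsy : (D.h F ψ).toModel q v ((D.ellSharp F ψ).toModel q)
        = (D.h F ψ).toModel q ((D.ellSharp F ψ).toModel q) v := hD.gam_symm _ _ _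
    have hzl : DifferentiableAt ℝ (VecField.inChart q (fun x ↦ (z ∘ ψ) x • D.ellSharp F ψ x))
        (extChartAt 𝓘(ℝ, F) q q) := by
      rw [VecField.inChart_smul]
      exact hzF.smul hellS
    rw [e, lieDeriv_add_toModel _ hzl hW, add_apply, add_apply,
      lieDeriv_smul_toModel _ (hzψ q) hellS, hsy, hD.h_ellSharp hψ hdim]
    rfl
  have hY : (D.gauge z V).Y.toModel (ψ q) = z (ψ q) • D.Y.toModel (ψ q)
      + symProd (D.ell.toModel (ψ q)) ((differential z).toModel (ψ q))
      + (1 / 2 : ℝ) • (lieDeriv (fun q ↦ z q • V q) D.gam).toModel (ψ q) := rfl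
  have hpar : ((D.gauge z V).ellPar F ψ).toModel q
      = z (ψ q) • ((D.ellPar F ψ).toModel q + (D.gamPar F ψ V).toModel q) := rfl
  have hsharp : ((D.gauge z V).ellSharp F ψ).toModel q
      = z (ψ q) • ((D.ellSharp F ψ).toModel q + (D.tangentPart F ψ V).toModel q) := by
    rw [gauge_ellSharp]; rfl
  have hell2 : (D.gauge z V).ell2 (ψ q) = z (ψ q) ^ 2 * (D.ell2 (ψ q)
      + 2 * D.ell.toModel (ψ q) (V.toModel (ψ q))
      + D.gam.toModel (ψ q) (V.toModel (ψ q)) (V.toModel (ψ q))) := rfl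
  have hU' := hD.gauge_U hz hz0 V (ψ q)
  have hdv := differential_comp (F := F) hz hψs q v
  have hdw := differential_comp (F := F) hz hψs q w
  have hln : D.ell.toModel (ψ q) (D.n.toModel (ψ q)) = 1 := hD.ell_n (ψ q)
  have hlV : D.ell.toModel (ψ q) (V.toModel (ψ q))
      = (D.ellPar F ψ).toModel q ((D.tangentPart F ψ V).toModel q) + D.normalPart F ψ V q := by
    nth_rw 1 [hD.decomposition hψ hdim V q]
    rw [map_add, map_smul, hln, smul_eq_mul, mul_one]
    rfl
  have hVn : D.gam.toModel (ψ q) (V.toModel (ψ q)) (D.n.toModel (ψ q)) = 0 :=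
    (hD.gam_symm (ψ q) _ _).trans
      (congrArg (fun L : E →L[ℝ] ℝ ↦ L (V.toModel (ψ q))) (hD.gam_toModel_n (ψ q)))
  have hVV : D.gam.toModel (ψ q) (V.toModel (ψ q)) (V.toModel (ψ q))
      = (D.gamPar F ψ V).toModel q ((D.tangentPart F ψ V).toModel q) := by
    nth_rw 2 [hD.decomposition hψ hdim V q]
    rw [map_add, map_smul, hVn, smul_zero, add_zero]
    rfl
  -- By symmetry of `h`, both mixed terms in the new `ℓ⁽²⁾_∥` equal `ℓ_∥(V_∥)`; they match the `2
  -- ℓ_∥(V_∥)` in the new `ℓ⁽²⁾`, leaving only `-2μ` in the difference.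
  have hsharpV : (D.gamPar F ψ V).toModel q ((D.ellSharp F ψ).toModel q)
      = (D.ellPar F ψ).toModel q ((D.tangentPart F ψ V).toModel q) := by
    rw [← hD.h_tangentPart hψ hdim, ← hD.h_ellSharp hψ hdim]
    exact hD.gam_symm _ _ _
  have hellv : ∀ u, (D.ellPar F ψ).toModel q u = D.ell.toModel (ψ q) (derivModel ψ q u) :=
    fun _ ↦ rfl
  have hh' : (D.gauge z V).h F ψ = D.h F ψ := rfl
  have hne := hz0 (ψ q)
  rw [sec_toModel, sec_toModel, hY, hh', hS, hpar, hsharp, hell2, hU', hlV, hVV]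
  rw [show FormField.pullback ψ D.gam = D.h F ψ from rfl] at hL
  simp only [map_add, map_smul, add_apply, smul_apply, smul_eq_mul, symProd_apply, hL, hU, hsharpV,
    ← hdv, ← hdw, ← hellv]
  field_simp
  ring

end Tuple

end HypersurfaceData

end

theorem lemma6p1 {m : ℕ}
    {N : Type*} [TopologicalSpace N] [ChartedSpace (EuclideanSpace ℝ (Fin (m + 1))) N]
    [IsManifold 𝓘(ℝ, EuclideanSpace ℝ (Fin (m + 1))) ∞ N]
    {S : Type*} [TopologicalSpace S] [ChartedSpace (EuclideanSpace ℝ (Fin m)) S]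
    [IsManifold 𝓘(ℝ, EuclideanSpace ℝ (Fin m)) ∞ S]
    (D : HypersurfaceData.Tuple (EuclideanSpace ℝ (Fin (m + 1))) N)
    (hD : D.IsNullHypersurfaceData)
    (ψ : S → N) (hψ : D.IsTransverse (EuclideanSpace ℝ (Fin m)) ψ)
    (z : N → ℝ) (hz : ContMDiff 𝓘(ℝ, EuclideanSpace ℝ (Fin (m + 1))) 𝓘(ℝ, ℝ) ∞ z)
    (hz0 : ∀ p, z p ≠ 0)
    (V : HypersurfaceData.VecField (EuclideanSpace ℝ (Fin (m + 1))) N) (hV : V.Smooth) :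
    (D.sec (EuclideanSpace ℝ (Fin m)) ψ).Symmetric ∧
    (∀ q : S, (D.gauge z V).omega (EuclideanSpace ℝ (Fin m)) ψ q
      = D.omega (EuclideanSpace ℝ (Fin m)) ψ q - (z (ψ q))⁻¹ • HypersurfaceData.differential (z ∘ ψ) q) ∧
    (∀ q : S, (D.gauge z V).sec (EuclideanSpace ℝ (Fin m)) ψ q = z (ψ q) • D.sec (EuclideanSpace ℝ (Fin m)) ψ q) := by
  have hdim : Module.finrank ℝ (EuclideanSpace ℝ (Fin (m + 1)))
      = Module.finrank ℝ (EuclideanSpace ℝ (Fin m)) + 1 := by simp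
  refine ⟨hD.sec_symm, fun q ↦ ?_, fun q ↦ ?_⟩
  · exact ContinuousLinearMap.ext fun v ↦ hD.gauge_omega hψ hdim hz hz0 hV q v
  · exact ContinuousLinearMap.ext fun v ↦ ContinuousLinearMap.ext fun w ↦
      hD.gauge_sec hψ hdim hz hz0 hV q v w
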